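/- Let $\tau=\frac{1+\sqrt5}{2}$, $\theta=\tau^2$, and let $\Lambda=\tau^{-2}\mathcal F_\tau$, where $\mathcal F_\tau=\{a+b\tau : a,b\in\mathbb Z,\ 0\le a-\frac b\tau<1\}$, be the rescaled Fibonacci chain, written as an increasing sequence $(\lambda_n)_{n\in\mathbb Z}$ with $\lambda_0=0$. Its tiles $[\lambda_n,\lambda_{n+1}]$ have length $1$ (letter L) or $1/\tau$ (letter S); a word of $k$ consecutive letters occurring in the chain is called admissible. For $m\ge2$ let $V^{(m)}$ be the space of functions in $L^2(\mathbb R)$ of class $C^{m-2}$ whose restriction to every $[\lambda_n,\lambda_{n+1}]$ is a polynomial of degree at most $m-1$. Let $s\ge2$. For $n\in\mathbb Z$ let $B_n$ be the B-spline of order $s$ at $\lambda_n$: the element of $V^{(s)}$ with support $[\lambda_n,\lambda']$, where $\lambda'\in\Lambda$ and $(\lambda_n,\lambda')$ contains exactly $s-1$ points of $\Lambda$, and with integral $(\lambda'-\lambda_n)/s$. The scaling functions are the functions $x\mapsto B_n(x+\lambda_n)$, $n\in\mathbb Z$. Let $E=\{n\in\mathbb Z:\lambda_{n+1}\notin\theta\Lambda\}$,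 and let $\widetilde W$ be the space of all $f\in V^{(2s)}$ that vanish on $\theta\Lambda$. For $n\in E$ let $\Psi_n\in\widetilde W$ be the function with compact support contained in $[\lambda_n,\infty)$, with $\Psi_n(\lambda_{n+1})=1$, and such that every $f\in\widetilde W$ with $\operatorname{supp} f\subset\operatorname{supp}\Psi_n$ is a scalar multiple of $\Psi_n$. Let $\zeta_n(x)=\Psi_n^{(s)}(x+\lambda_n)$, and let $\psi_n(x)=\zeta_n(\theta x)/\|\zeta_n(\theta\,\cdot)\|_{L^2}$ be the corresponding mother wavelet. Then: (1) $B_n$ exists and is unique for every $n\in\mathbb Z$; there are exactly $s+1$ admissible $s$-letter words and exactly $s+1$ distinct scaling functions; the function $x\mapsto B_n(x+\lambda_n)$ depends only on the $s$-letter word with left-hand end $\lambda_n$, and this gives a bijection between admissible $s$-letter words and scaling functions. (2) $\Psi_n$ exists and is unique for every $n\in E$; there are exactly $2s$ distinct wavelets, that is, each of the sets $\{\Psi_n(\cdot+\lambda_n):n\in E\}$, $\{\zeta_n:n\in E\}$ and $\{\psi_n:n\in E\}$ has exactly $2s$ elements. (3) With $p=\lceil(2s-2)\tau\rceil+1$,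 for every $n\in E$ the functions $\Psi_n$ and $\Psi_n^{(s)}$ have the same support $[\lambda_n,\lambda_{n+N}]$, where the number $N$ of letters is $p$ or $p+1$; both lengths occur. -/

import Mathlib

open MeasureTheory Set

namespace FibSpline

/-- The Fibonacci chain `{a + b τ | a, b ∈ ℤ, a - b / τ ∈ [0, 1)}`. -/
def fibonacciChain : Set ℝ :=
  {x | ∃ a b : ℤ, x = a + b * Real.goldenRatio ∧ (a : ℝ) - b / Real.goldenRatio ∈ Ico (0 : ℝ) 1}

/-- The rescaled Fibonacci chain, that is, the Fibonacci chain divided by `τ²`. -/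
def rescaledChain : Set ℝ :=
  (fun x : ℝ => x / Real.goldenRatio ^ 2) '' fibonacciChain

/-- The rescaled Fibonacci chain has an increasing enumeration by `ℤ` that starts at `0`. -/
theorem exists_enumeration :
    ∃ lam : ℤ → ℝ, StrictMono lam ∧ range lam = rescaledChain ∧ lam 0 = 0 := by
  have hτ : 0 < Real.goldenRatio := Real.goldenRatio_pos
  refine ⟨fun k => ((⌈(k : ℝ) / Real.goldenRatio⌉ : ℤ) + k * Real.goldenRatio) /
    Real.goldenRatio ^ 2, ?_, ?_, ?_⟩
  · intro j k hjk
    have hjk' : (j : ℝ) < k := by exact_mod_cast hjk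
    have h1 : ((⌈(j : ℝ) / Real.goldenRatio⌉ : ℤ) : ℝ) ≤ (⌈(k : ℝ) / Real.goldenRatio⌉ : ℤ) := by
      exact_mod_cast Int.ceil_mono (by gcongr)
    have h2 : (j : ℝ) * Real.goldenRatio < k * Real.goldenRatio := by gcongr
    exact div_lt_div_of_pos_right (add_lt_add_of_le_of_lt h1 h2) (by positivity)
  · ext x
    constructor
    · rintro ⟨k, rfl⟩
      refine ⟨_, ⟨⌈(k : ℝ) / Real.goldenRatio⌉, k, rfl, ?_, ?_⟩, rfl⟩
      · linarith [Int.le_ceil ((k : ℝ) / Real.goldenRatio)]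
      · linarith [Int.ceil_lt_add_one ((k : ℝ) / Real.goldenRatio)]
    · rintro ⟨_, ⟨a, b, rfl, h0, h1⟩, rfl⟩
      have ha : ⌈(b : ℝ) / Real.goldenRatio⌉ = a := by
        rw [Int.ceil_eq_iff]
        constructor <;> linarith
      exact ⟨b, by simp [ha]⟩
  · simp

/-- The two tiles: long and short. -/
inductive Letter
  | L
  | S

/-- In the rescaled chain the long tile has length `1` and the short one `1 / τ`. -/
noncomputable def Letter.length : Letter → ℝ
  | Letter.L => 1
  | Letter.S => 1 / Real.goldenRatio

/-- `lam n` is the left-hand end of the `k`-letter word `w`. -/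
def IsWordAt (lam : ℤ → ℝ) {k : ℕ} (n : ℤ) (w : Fin k → Letter) : Prop :=
  ∀ i : Fin k, lam (n + ((i : ℕ) : ℤ) + 1) - lam (n + ((i : ℕ) : ℤ)) = (w i).length

/-- The admissible `k`-letter words, i.e. those that occur somewhere in the chain. -/
def admissibleWords (lam : ℤ → ℝ) (k : ℕ) : Set (Fin k → Letter) :=
  {w | ∃ n : ℤ, IsWordAt lam n w}

/-- Square-integrable splines of order `m` (`m ≥ 2`) with nodes `lam n`, `n ∈ ℤ`: functions of
class `C^(m-2)` which on every `[lam n, lam (n+1)]` are polynomials of degree at most `m - 1`. -/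
def splineSpace (𝕜 : Type*) [RCLike 𝕜] (lam : ℤ → ℝ) (m : ℕ) : Set (ℝ → 𝕜) :=
  {f | ContDiff ℝ ((m - 2 : ℕ) : WithTop ℕ∞) f ∧ MemLp f 2 volume ∧
    ∀ n : ℤ, ∃ P : Polynomial 𝕜, P.degree < (m : WithBot ℕ) ∧
      ∀ x ∈ Icc (lam n) (lam (n + 1)), f x = P.eval (x : 𝕜)}

/-- `B` is the B-spline of order `s` attached to the node `lam n`. -/
def IsBSpline {𝕜 : Type*} [RCLike 𝕜] (lam : ℤ → ℝ) (s : ℕ) (n : ℤ) (B : ℝ → 𝕜) : Prop :=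
  B ∈ splineSpace 𝕜 lam s ∧
  ∃ n' : ℤ, tsupport B = Icc (lam n) (lam n') ∧
    (Ioo (lam n) (lam n') ∩ range lam).ncard = s - 1 ∧
    ∫ x, B x = (((lam n' - lam n) / s : ℝ) : 𝕜)

/-- The B-spline scaling functions: the functions `x ↦ B (x + lam n)`, where `B` is the B-spline
attached to `lam n` and `n` runs through `ℤ`. -/
def scalingFunctions (𝕜 : Type*) [RCLike 𝕜] (lam : ℤ → ℝ) (s : ℕ) : Set (ℝ → 𝕜) :=
  {φ | ∃ (n : ℤ) (B : ℝ → 𝕜), IsBSpline lam s n B ∧ φ = fun x => B (x + lam n)}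

/-- Splines of order `m` which vanish on the inflated node set `θ Λ`. -/
def vanishingSplines (𝕜 : Type*) [RCLike 𝕜] (lam : ℤ → ℝ) (θ : ℝ) (m : ℕ) : Set (ℝ → 𝕜) :=
  {f | f ∈ splineSpace 𝕜 lam m ∧ ∀ k : ℤ, f (θ * lam k) = 0}

/-- The indices `n` for which the next node `lam (n+1)` is not in `θ Λ`. -/
def indexSet (lam : ℤ → ℝ) (θ : ℝ) : Set ℤ :=
  {n | lam (n + 1) ∉ range (fun k : ℤ => θ * lam k)}

/-- `Ψ` is the spline of order `m` attached to `n` which vanishes on `θ Λ`, has compact support in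
`[lam n, ∞)`, takes the value `1` at `lam (n+1)`, and has minimal support. -/
def IsMinimalSpline {𝕜 : Type*} [RCLike 𝕜] (lam : ℤ → ℝ) (θ : ℝ) (m : ℕ) (n : ℤ)
    (Ψ : ℝ → 𝕜) : Prop :=
  Ψ ∈ vanishingSplines 𝕜 lam θ m ∧
  HasCompactSupport Ψ ∧ tsupport Ψ ⊆ Ici (lam n) ∧
  Ψ (lam (n + 1)) = 1 ∧
  ∀ f ∈ vanishingSplines 𝕜 lam θ m, tsupport f ⊆ tsupport Ψ → ∃ c : 𝕜, f = fun x => c * Ψ x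

/-- The shapes `x ↦ Ψ (x + lam n)` of the minimally supported splines of order `2 s`. -/
def minimalShapes (𝕜 : Type*) [RCLike 𝕜] (lam : ℤ → ℝ) (θ : ℝ) (s : ℕ) : Set (ℝ → 𝕜) :=
  {g | ∃ n ∈ indexSet lam θ, ∃ Ψ : ℝ → 𝕜, IsMinimalSpline lam θ (2 * s) n Ψ ∧
    g = fun x => Ψ (x + lam n)}

/-- The wavelet shapes of order `s`: the functions `x ↦ Ψ⁽ˢ⁾ (x + lam n)`, where `Ψ` is the
minimally supported spline of order `2 s` attached to `n`. -/
def waveletShapes (𝕜 : Type*) [RCLike 𝕜] (lam : ℤ → ℝ) (θ : ℝ) (s : ℕ) : Set (ℝ → 𝕜) :=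
  {ζ | ∃ n ∈ indexSet lam θ, ∃ Ψ : ℝ → 𝕜, IsMinimalSpline lam θ (2 * s) n Ψ ∧
    ζ = fun x => iteratedDeriv s Ψ (x + lam n)}

/-- The mother wavelets of order `s`: the wavelet shapes, contracted by the factor `θ` and
normalized in `L²`. -/
noncomputable def motherWavelets (𝕜 : Type*) [RCLike 𝕜] (lam : ℤ → ℝ) (θ : ℝ) (s : ℕ) :
    Set (ℝ → 𝕜) :=
  {ψ | ∃ ζ ∈ waveletShapes 𝕜 lam θ s,
    ψ = fun x => ((eLpNorm (fun y => ζ (θ * y)) 2 volume).toReal)⁻¹ • ζ (θ * x)}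

end FibSpline

/-! Everything rests on a zero count of Rolle type. Let a spline of order `q + 2` vanish to the left
of node `a` and on tile `b`, but identically on no tile in between. If it is zero at `z` of the
nodes `a + 1, ..., b`, it makes at least `z + 1` swings of alternating direction. Each
differentiation adds one, because the derivative starts from 0 and returns to 0. The derivative of
order `q` is affine on each of the `b - a` tiles, so `z + 1 + q ≤ b - a`: at least `q + 1` nodes are
not zeros (`IsSpline.le_card_ne_zero`). In the case of equality the slopes of that derivative are
nonzero and alternate in sign from tile to tile.

A window is a range of nodes with exactly `q + 1` interior nodes outside a prescribed zero set `Z`.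
A dimension count gives a nonzero spline on it; the zero count makes it unique up to a factor and
holds with equality. So its derivatives up to order `q` are supported on the whole window and break
at every node: the shape determines the nodes (`IsWindowSpline.nodes_eq`), and by uniqueness the
nodes, together with the zero set, determine the shape. B-splines are the case `Z = ∅`, `q = s - 2`;
for the minimal splines `q = 2 s - 2` and `Z` consists of the nodes in `θ Λ`.

It remains to count node patterns. The long tiles have the indices `⌊k τ⌋`, and by Beatty's theorem
these indices form `E`. Words of `s` letters correspond to the increments of `⌊-n / τ⌋` over `s`
steps, wavelets to those of `⌊k τ⌋` over `2 s - 1` steps. For irrational `α` the sequence `⌊n α⌋`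
has `K + 1` patterns over `K` steps (`ncard_range_floorIncrements`), which gives `s + 1` and `2 s`.
-/

namespace FibSpline

/-! ### Oscillations and sign alternations -/

/-- A chain of `k` strict increments of `g` of alternating sign, ending at `x`; the last increment
has the sign of `δ`. -/
inductive Oscillates (g : ℝ → ℝ) : ℕ → ℝ → ℝ → Prop
  | base {x y δ : ℝ} (hxy : x < y) (h : 0 < δ * (g y - g x)) : Oscillates g 1 y δ
  | step {k : ℕ} {x y δ : ℝ} (hx : Oscillates g k x δ) (hxy : x < y)
      (h : 0 < -δ * (g y - g x)) : Oscillates g (k + 1) y (-δ)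

/-- A chain of `k` points at which `g` alternates in sign; at the last point `x` it has the sign
of `δ`. -/
inductive Alternates {α : Type*} [LT α] (g : α → ℝ) : ℕ → α → ℝ → Prop
  | base {x : α} {δ : ℝ} (h : 0 < δ * g x) : Alternates g 1 x δ
  | step {k : ℕ} {x y : α} {δ : ℝ} (hx : Alternates g k x δ) (hxy : x < y)
      (h : 0 < -δ * g y) : Alternates g (k + 1) y (-δ)

namespace Oscillates

variable {g : ℝ → ℝ} {k : ℕ} {x y δ : ℝ}

theorem ne_zero (h : Oscillates g k x δ) : δ ≠ 0 := by
  cases h with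
  | base _ h => rintro rfl; simp at h
  | step _ _ h => intro h0; simp [h0] at h

theorem extend (h : Oscillates g k x δ) (hxy : x < y) (hg : 0 < δ * (g y - g x)) :
    Oscillates g k y δ := by
  cases h with
  | base hx h => exact base (hx.trans hxy) (by linarith)
  | step h0 hx h => exact step h0 (hx.trans hxy) (by linarith)

/-- The first increment is the one dropped, so the end point and its sign are kept. -/
theorem of_succ (h : Oscillates g (k + 2) x δ) : Oscillates g (k + 1) x δ := by
  induction k generalizing x δ with
  | zero =>
    cases h with
    | step _ hx h => exact base hx h
  | succ k ih =>
    cases h with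
    | step h0 hx h => exact step (ih h0) hx h

/-- If the move to `p` continues the last increment, only the return to zero is new. Otherwise the
excursion adds two increments and `of_succ` discards one. -/
theorem pass_zero {u p v : ℝ} (h : Oscillates g k u δ) (hup : u < p) (hpv : p < v)
    (hu : g u = 0) (hp : g p ≠ 0) (hv : g v = 0) : ∃ δ', Oscillates g (k + 1) v δ' := by
  rcases lt_or_gt_of_ne (mul_ne_zero h.ne_zero hp) with h' | h'
  · have h1 : Oscillates g (k + 1) p (-δ) := h.step hup (by rw [hu]; linarith)
    have h2 : Oscillates g (k + 2) v (-(-δ)) := h1.step hpv (by rw [hv]; linarith)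
    exact ⟨_, h2.of_succ⟩
  · have h1 : Oscillates g k p δ := h.extend hup (by rw [hu]; linarith)
    exact ⟨_, h1.step hpv (by rw [hv]; linarith)⟩

theorem of_zeros {u p v : ℝ} (hup : u < p) (hpv : p < v)
    (hu : g u = 0) (hp : g p ≠ 0) (hv : g v = 0) : ∃ δ', Oscillates g 2 v δ' := by
  have hpp : 0 < g p * g p := mul_self_pos.2 hp
  exact ⟨_, (base (δ := g p) hup (by rw [hu]; linarith)).step hpv (by rw [hv]; linarith)⟩

/-- Mean value theorem on each increment; the intervals do not overlap, so the points found are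
increasing. -/
theorem alternates_deriv (hg : Differentiable ℝ g) (h : Oscillates g k x δ) :
    ∃ y < x, Alternates (deriv g) k y δ := by
  have key : ∀ {a b c : ℝ}, a < b → 0 < c * (g b - g a) →
      ∃ y ∈ Ioo a b, 0 < c * deriv g y := by
    intro a b c hab h
    obtain ⟨y, hy, hd⟩ := exists_deriv_eq_slope g hab hg.continuous.continuousOn
      hg.differentiableOn
    refine ⟨y, hy, ?_⟩
    rw [hd, ← mul_div_assoc]
    exact div_pos h (sub_pos.2 hab)
  induction h with
  | base hx h =>
    obtain ⟨y, hy, hd⟩ := key hx h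
    exact ⟨y, hy.2, .base hd⟩
  | step _ hx h ih =>
    obtain ⟨y, hy, hd⟩ := key hx h
    obtain ⟨z, hz, hz'⟩ := ih
    exact ⟨y, hy.2, hz'.step (hz.trans hy.1) hd⟩

end Oscillates

namespace Alternates

theorem mul_pos_last {α : Type*} [LT α] {g : α → ℝ} {k : ℕ} {x : α} {δ : ℝ}
    (h : Alternates g k x δ) : 0 < δ * g x := by
  cases h with
  | base h => exact h
  | step _ _ h => exact h

/-- The initial zero turns the first sign into an increment, so no alternation is lost. -/
theorem oscillates {g : ℝ → ℝ} {k : ℕ} {y δ a : ℝ} (h : Alternates g k y δ)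
    (hg : ∀ x ≤ a, g x = 0) : Oscillates g k y δ := by
  induction h with
  | @base x δ h =>
    have hax : a < x := by
      by_contra! hle
      simp [hg x hle] at h
    exact .base hax (by rw [hg a le_rfl]; linarith)
  | @step k x y δ hx hxy h ih =>
    refine ih.step hxy ?_
    linarith [hx.mul_pos_last]

/-- The chain consists of `k` distinct indices between `a` and `j`; in the case of equality it skips
none. -/
theorem le_sub {c : ℤ → ℝ} {k : ℕ} {j a : ℤ} {δ : ℝ} (h : Alternates c k j δ)
    (hc : ∀ i < a, c i = 0) : (k : ℤ) ≤ j + 1 - a ∧ ((k : ℤ) = j + 1 - a →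
      (∀ i, a ≤ i → i ≤ j → c i ≠ 0) ∧ ∀ i, a ≤ i → i < j → c i * c (i + 1) < 0) := by
  induction h with
  | @base j δ h =>
    have hj : a ≤ j := by
      by_contra! hle
      simp [hc j hle] at h
    refine ⟨by push_cast; omega, fun e => ⟨fun i h1 h2 => ?_, fun i h1 h2 => ?_⟩⟩
    · obtain rfl : i = j := by push_cast at e; omega
      rintro h0
      simp [h0] at h
    · push_cast at e; omega
  | @step k i j δ hx hxy h ih =>
    obtain ⟨h1, h2⟩ := ih
    refine ⟨by push_cast; omega, fun e => ?_⟩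
    push_cast at e
    obtain rfl : j = i + 1 := by omega
    obtain ⟨h3, h4⟩ := h2 (by omega)
    refine ⟨fun l hl hl' => ?_, fun l hl hl' => ?_⟩
    · rcases hl'.lt_or_eq with h' | rfl
      · exact h3 l hl (by omega)
      · intro h0; simp [h0] at h
    · rcases (Int.lt_add_one_iff.1 hl').lt_or_eq with h' | rfl
      · exact h4 l hl h'
      · have h5 : 0 < (δ * c l) * (-δ * c (l + 1)) := mul_pos hx.mul_pos_last h
        by_contra! h6
        nlinarith [mul_nonneg (sq_nonneg δ) h6]

end Alternates

/-! ### Splines and the zero count -/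

theorem eqOn_iteratedDeriv_zero {f : ℝ → ℝ} {q i : ℕ} (hf : ContDiff ℝ q f) (hi : i ≤ q)
    {U : Set ℝ} (hU : IsOpen U) (h : EqOn f 0 U) : EqOn (iteratedDeriv i f) 0 (closure U) := by
  refine EqOn.closure (fun x hx => ?_) (hf.continuous_iteratedDeriv i (by exact_mod_cast hi))
    continuous_const
  have : f =ᶠ[nhds x] fun _ => 0 := Filter.eventuallyEq_of_mem (hU.mem_nhds hx) h
  rw [this.iteratedDeriv_eq i]
  simp

/-- Real splines of order `q + 2` with nodes `lam n`, without an integrability condition. -/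
structure IsSpline (lam : ℤ → ℝ) (q : ℕ) (f : ℝ → ℝ) : Prop where
  contDiff : ContDiff ℝ q f
  piece : ∀ n : ℤ, ∃ P : Polynomial ℝ, P.degree < ((q + 2 : ℕ) : WithBot ℕ) ∧
    ∀ x ∈ Icc (lam n) (lam (n + 1)), f x = P.eval x

namespace IsSpline

variable {lam : ℤ → ℝ} {q : ℕ} {f : ℝ → ℝ}

theorem deriv (hl : StrictMono lam) (hf : IsSpline lam (q + 1) f) :
    IsSpline lam q (deriv f) := by
  have hc : ContDiff ℝ q (_root_.deriv f) := by
    have h := hf.contDiff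
    push_cast at h
    exact (contDiff_succ_iff_deriv.1 h).2.2
  refine ⟨hc, fun n => ?_⟩
  obtain ⟨P, hP, hPf⟩ := hf.piece n
  refine ⟨Polynomial.derivative P, ?_, ?_⟩
  · rcases eq_or_ne P 0 with rfl | h0
    · rw [Polynomial.derivative_zero, Polynomial.degree_zero]
      exact WithBot.bot_lt_coe _
    · have h1 := Polynomial.degree_derivative_lt h0
      have h2 : P.degree ≤ ((q + 2 : ℕ) : WithBot ℕ) := by
        rw [Polynomial.degree_eq_natDegree h0] at hP ⊢
        norm_cast at hP ⊢
        omega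
      exact lt_of_lt_of_le h1 h2
  · have hlt : lam n < lam (n + 1) := hl (by omega)
    rw [← closure_Ioo hlt.ne]
    refine EqOn.closure (fun x hx => ?_) hc.continuous (Polynomial.continuous _)
    have : f =ᶠ[nhds x] fun y => P.eval y :=
      Filter.eventuallyEq_of_mem (isOpen_Ioo.mem_nhds hx) fun y hy => hPf y (Ioo_subset_Icc_self hy)
    rw [this.deriv_eq, Polynomial.deriv]

theorem iteratedDeriv (hl : StrictMono lam) (i : ℕ) (hf : IsSpline lam (q + i) f) :
    IsSpline lam q (iteratedDeriv i f) := by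
  induction i generalizing f with
  | zero => simpa using hf
  | succ i ih =>
    rw [iteratedDeriv_succ']
    exact ih (hf.deriv hl)

theorem add {g : ℝ → ℝ} (hf : IsSpline lam q f) (hg : IsSpline lam q g) :
    IsSpline lam q (fun x => f x + g x) := by
  refine ⟨hf.contDiff.add hg.contDiff, fun n => ?_⟩
  obtain ⟨P, hP, hPf⟩ := hf.piece n
  obtain ⟨Q, hQ, hQf⟩ := hg.piece n
  exact ⟨P + Q, (Polynomial.degree_add_le _ _).trans_lt (max_lt hP hQ), fun x hx => by
    rw [hPf x hx, hQf x hx, Polynomial.eval_add]⟩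

theorem const_mul (c : ℝ) (hf : IsSpline lam q f) : IsSpline lam q (fun x => c * f x) := by
  refine ⟨contDiff_const.mul hf.contDiff, fun n => ?_⟩
  obtain ⟨P, hP, hPf⟩ := hf.piece n
  refine ⟨Polynomial.C c * P, ?_, fun x hx => by rw [hPf x hx]; simp⟩
  rw [← Polynomial.smul_eq_C_mul]
  exact (Polynomial.degree_smul_le _ _).trans_lt hP

theorem neg (hf : IsSpline lam q f) : IsSpline lam q (fun x => - f x) := by
  simpa using hf.const_mul (-1)

theorem sub {g : ℝ → ℝ} (hf : IsSpline lam q f) (hg : IsSpline lam q g) :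
    IsSpline lam q (fun x => f x - g x) := by
  simpa [sub_eq_add_neg] using hf.add hg.neg

theorem affine_piece (hl : StrictMono lam) (hf : IsSpline lam 0 f) (n : ℤ) :
    ∃ c d : ℝ, (∀ x ∈ Icc (lam n) (lam (n + 1)), f x = c * x + d) ∧
      f (lam (n + 1)) - f (lam n) = c * (lam (n + 1) - lam n) := by
  obtain ⟨P, hP, hPf⟩ := hf.piece n
  have hlt : lam n ≤ lam (n + 1) := hl.monotone (by omega)
  have h1 : P.degree ≤ 1 := (Polynomial.degree_le_iff_coeff_zero _ _).2 fun m hm =>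
    (Polynomial.degree_lt_iff_coeff_zero _ _).1 hP m (by norm_cast at hm)
  rw [Polynomial.eq_X_add_C_of_degree_le_one h1] at hPf
  refine ⟨_, _, fun x hx => by rw [hPf x hx]; simp; rfl, ?_⟩
  rw [hPf _ ⟨le_rfl, hlt⟩, hPf _ ⟨hlt, le_rfl⟩]
  simp; ring

/-- Otherwise `δ * f` would be nonincreasing on every tile that meets the interval, hence across it.
-/
theorem exists_slope (hl : StrictMono lam) (hcov : ∀ x, ∃ j, lam j ≤ x ∧ x < lam (j + 1))
    (hf : IsSpline lam 0 f) {x y δ : ℝ} (hxy : x < y) (h : 0 < δ * (f y - f x)) :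
    ∃ j, lam j < y ∧ x < lam (j + 1) ∧ 0 < δ * (f (lam (j + 1)) - f (lam j)) := by
  by_contra! hno
  have tile : ∀ j u v, lam j ≤ u → u ≤ v → v ≤ lam (j + 1) → v ≤ y → x < lam (j + 1) →
      δ * (f v - f u) ≤ 0 := by
    intro j u v hu huv hv hvy hx
    rcases huv.eq_or_lt with rfl | huv'
    · simp
    obtain ⟨c, d, hcd, hs⟩ := hf.affine_piece hl j
    have h1 := hno j (by linarith) hx
    rw [hs] at h1
    rw [hcd v ⟨by linarith, hv⟩, hcd u ⟨hu, by linarith⟩]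
    have h2 : 0 < lam (j + 1) - lam j := sub_pos.2 (hl (by omega))
    have h3 : δ * c ≤ 0 := by
      by_contra! h4
      nlinarith [mul_pos h4 h2]
    nlinarith
  obtain ⟨j₀, h1, h2⟩ := hcov x
  have key : ∀ j, j₀ + 1 ≤ j → ∀ z, x ≤ z → z ≤ lam j → z ≤ y → δ * (f z - f x) ≤ 0 := by
    intro j hj
    induction j, hj using Int.leInduction with
    | base => exact fun z hz hz' hzy => tile j₀ x z h1 hz hz' hzy h2
    | succ j hj ih =>
      intro z hz hz' hzy
      have h3 : x < lam j := h2.trans_le (hl.monotone hj)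
      rcases le_total z (lam j) with h4 | h4
      · exact ih z hz h4 hzy
      · have h5 := ih (lam j) h3.le le_rfl (h4.trans hzy)
        have h6 := tile j (lam j) z le_rfl h4 hz' hzy (h3.trans (hl (by omega)))
        linarith
  obtain ⟨j₁, h3, h4⟩ := hcov y
  have h5 : j₀ < j₁ + 1 := hl.lt_iff_lt.1 (by linarith)
  have := key (j₁ + 1) (by omega) y hxy.le h4.le le_rfl
  linarith

/-- Every derivative of a compactly supported spline has one more alternation. -/
theorem exists_alternates (hl : StrictMono lam) (hcov : ∀ x, ∃ j, lam j ≤ x ∧ x < lam (j + 1))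
    (hf : IsSpline lam q f) {a b : ℤ} (ha : ∀ x ≤ lam a, f x = 0)
    (hb : ∀ i ≤ q, _root_.iteratedDeriv i f (lam b) = 0) {k : ℕ} {x δ : ℝ}
    (ho : Oscillates f k x δ) (hx : x ≤ lam b) :
    ∃ j < b, ∃ δ', Alternates (fun j => _root_.iteratedDeriv q f (lam (j + 1)) -
      _root_.iteratedDeriv q f (lam j)) (k + q) j δ' := by
  induction q generalizing f k x δ with
  | zero =>
    simp only [iteratedDeriv_zero, add_zero]
    suffices h : ∃ j, lam j < x ∧
        Alternates (fun j => f (lam (j + 1)) - f (lam j)) k j δ by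
      obtain ⟨j, hj, hj'⟩ := h
      exact ⟨j, hl.lt_iff_lt.1 (hj.trans_le hx), δ, hj'⟩
    clear hx
    induction ho with
    | base hxy h =>
      obtain ⟨j, h1, -, h2⟩ := hf.exists_slope hl hcov hxy h
      exact ⟨j, h1, .base h2⟩
    | step _ hxy h ih =>
      obtain ⟨i, hi, hi'⟩ := ih
      obtain ⟨j, h1, h2, h3⟩ := hf.exists_slope hl hcov hxy h
      refine ⟨j, h1, hi'.step ?_ h3⟩
      -- The same tile cannot serve two consecutive increments, because they have opposite signs.
      have h4 : i < j + 1 := hl.lt_iff_lt.1 (hi.trans h2)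
      rcases (Int.lt_add_one_iff.1 h4).lt_or_eq with h5 | rfl
      · exact h5
      · have := hi'.mul_pos_last
        linarith
  | succ q ih =>
    have hd : Differentiable ℝ f := hf.contDiff.differentiable (by simp)
    have hf' := hf.deriv hl
    have ha' : ∀ x ≤ lam a, _root_.deriv f x = 0 := by
      intro x hx
      have := eqOn_iteratedDeriv_zero (i := 1) hf.contDiff (by omega) (isOpen_Iio (a := lam a))
        (fun y hy => ha y (le_of_lt hy))
      rw [closure_Iio, iteratedDeriv_one] at this
      exact this hx
    have hb' : ∀ i ≤ q, _root_.iteratedDeriv i (_root_.deriv f) (lam b) = 0 := by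
      intro i hi
      rw [← iteratedDeriv_succ']
      exact hb _ (by omega)
    obtain ⟨y, hy, hya⟩ := ho.alternates_deriv hd
    have hyb : y < lam b := hy.trans_le hx
    -- The return to 0 at `lam b` is the additional increment.
    have h1 := (hya.oscillates ha').step hyb (by
      have h2 := hya.mul_pos_last
      have h3 : _root_.deriv f (lam b) = 0 := by simpa using hb' 0 (by omega)
      rw [h3]; linarith)
    obtain ⟨j, hj, δ', h2⟩ := ih hf' ha' hb' h1 le_rfl
    rw [iteratedDeriv_succ', show k + (q + 1) = k + 1 + q by ring]
    exact ⟨j, hj, δ', h2⟩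

/-- Here `u` is the last zero node reached. The first excursion between two zeros gives two
increments, every later one gives one more; the alternative `card = 0` means that no excursion is
complete yet. -/
theorem exists_oscillates_of_zeros (hl : StrictMono lam) {a b : ℤ} (ha : f (lam a) = 0)
    (hne : ∀ j, a ≤ j → j < b → ∃ x ∈ Ioo (lam j) (lam (j + 1)), f x ≠ 0) {j : ℤ} (hj : a ≤ j)
    (hjb : j ≤ b) : ∃ u ≤ lam j, f u = 0 ∧ (((Finset.Ioc a j).filter (fun i => f (lam i) = 0)).card = 0 ∨
      ∃ δ, Oscillates f (((Finset.Ioc a j).filter (fun i => f (lam i) = 0)).card + 1) u δ) := by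
  induction j, hj using Int.leInduction with
  | base => exact ⟨lam a, le_rfl, ha, by simp⟩
  | succ j hj ih =>
    obtain ⟨u, hu, hu0, hu'⟩ := ih (by omega)
    have hI : Finset.Ioc a (j + 1) = insert (j + 1) (Finset.Ioc a j) := by
      ext i; simp only [Finset.mem_Ioc, Finset.mem_insert]; omega
    rw [hI, Finset.filter_insert]
    split_ifs with h0
    · rw [Finset.card_insert_of_notMem (by simp)]
      obtain ⟨p, hp, hp0⟩ := hne j hj (by omega)
      refine ⟨_, le_rfl, h0, Or.inr ?_⟩
      rcases hu' with h | ⟨δ, h⟩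
      · rw [h]
        exact Oscillates.of_zeros (hu.trans_lt hp.1) hp.2 hu0 hp0 h0
      · exact h.pass_zero (hu.trans_lt hp.1) hp.2 hu0 hp0 h0
    · exact ⟨u, hu.trans (hl.monotone (by omega)), hu0, hu'⟩

theorem iteratedDeriv_eq_zero_of_tile (hl : StrictMono lam) (hf : IsSpline lam q f) {b : ℤ}
    (hb : ∀ x ∈ Icc (lam b) (lam (b + 1)), f x = 0) {i : ℕ} (hi : i ≤ q) :
    _root_.iteratedDeriv i f (lam b) = 0 := by
  have hlt : lam b < lam (b + 1) := hl (by omega)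
  have := eqOn_iteratedDeriv_zero hf.contDiff hi (isOpen_Ioo (a := lam b) (b := lam (b + 1)))
    (fun y hy => hb y (Ioo_subset_Icc_self hy))
  rw [closure_Ioo hlt.ne] at this
  exact this ⟨le_rfl, hlt.le⟩

theorem iteratedDeriv_eq_zero_of_le {a : ℤ} (hf : IsSpline lam q f)
    (ha : ∀ x ≤ lam a, f x = 0) {i : ℕ} (hi : i ≤ q) :
    ∀ x ≤ lam a, _root_.iteratedDeriv i f x = 0 := by
  intro x hx
  have := eqOn_iteratedDeriv_zero hf.contDiff hi (isOpen_Iio (a := lam a))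
    (fun y hy => ha y (le_of_lt hy))
  rw [closure_Iio] at this
  exact this hx

theorem exists_mem_Ioo_ne_zero (hl : StrictMono lam) (hf : Continuous f) {j : ℤ}
    (h : ∃ x ∈ Icc (lam j) (lam (j + 1)), f x ≠ 0) :
    ∃ x ∈ Ioo (lam j) (lam (j + 1)), f x ≠ 0 := by
  by_contra! hno
  obtain ⟨x, hx, hx0⟩ := h
  have hlt : lam j < lam (j + 1) := hl (by omega)
  rw [← closure_Ioo hlt.ne] at hx
  exact hx0 (EqOn.closure (g := fun _ => 0) (fun y hy => hno y hy) hf continuous_const hx)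

/-- The slopes of the last continuous derivative, multiplied by the lengths of the tiles. -/
noncomputable def increment (lam : ℤ → ℝ) (q : ℕ) (f : ℝ → ℝ) (j : ℤ) : ℝ :=
  _root_.iteratedDeriv q f (lam (j + 1)) - _root_.iteratedDeriv q f (lam j)

theorem increment_alternates_of_oscillates (hl : StrictMono lam)
    (hcov : ∀ x, ∃ j, lam j ≤ x ∧ x < lam (j + 1))
    (hf : IsSpline lam q f) {a b : ℤ} (ha : ∀ x ≤ lam a, f x = 0)
    (hb : ∀ i ≤ q, _root_.iteratedDeriv i f (lam b) = 0) {k : ℕ} {x δ : ℝ}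
    (ho : Oscillates f k x δ) (hx : x ≤ lam b) : (k + q : ℤ) ≤ b - a ∧ ((k + q : ℤ) = b - a →
      (∀ i, a ≤ i → i < b → increment lam q f i ≠ 0) ∧
      ∀ i, a ≤ i → i + 1 < b → increment lam q f i * increment lam q f (i + 1) < 0) := by
  obtain ⟨j, hj, δ', h⟩ := hf.exists_alternates hl hcov ha hb ho hx
  have h0 : ∀ i < a, increment lam q f i = 0 := by
    intro i hi
    have := hf.iteratedDeriv_eq_zero_of_le ha le_rfl
    rw [increment, this _ (hl.monotone (by omega)), this _ (hl.monotone (by omega)), sub_zero]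
  obtain ⟨h1, h2⟩ := h.le_sub h0
  push_cast at h1 h2
  refine ⟨by omega, fun e => ?_⟩
  obtain ⟨h3, h4⟩ := h2 (by omega)
  exact ⟨fun i hi hi' => h3 i hi (by omega), fun i hi hi' => h4 i hi (by omega)⟩

/-- A spline of order `q + 2` which vanishes on no tile between two of its zero tiles is nonzero
at `q + 1` nodes at least. -/
theorem le_card_ne_zero (hl : StrictMono lam) (hcov : ∀ x, ∃ j, lam j ≤ x ∧ x < lam (j + 1))
    (hf : IsSpline lam q f) {a b : ℤ} (hab : a < b) (ha : ∀ x ≤ lam a, f x = 0)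
    (hne : ∀ j, a ≤ j → j < b → ∃ x ∈ Icc (lam j) (lam (j + 1)), f x ≠ 0)
    (hb : ∀ x ∈ Icc (lam b) (lam (b + 1)), f x = 0) :
    q + 1 ≤ ((Finset.Ioc a b).filter (fun i => f (lam i) ≠ 0)).card ∧
    (((Finset.Ioc a b).filter (fun i => f (lam i) ≠ 0)).card = q + 1 →
      (∀ i, a ≤ i → i < b → increment lam q f i ≠ 0) ∧
      ∀ i, a ≤ i → i + 1 < b → increment lam q f i * increment lam q f (i + 1) < 0) := by
  have hcard := Finset.card_filter_add_card_filter_not (s := Finset.Ioc a b) (fun i => f (lam i) = 0)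
  obtain ⟨u, hu, -, h⟩ := exists_oscillates_of_zeros hl (ha _ le_rfl)
    (fun j h1 h2 => exists_mem_Ioo_ne_zero hl hf.contDiff.continuous (hne j h1 h2)) hab.le le_rfl
  rw [Int.card_Ioc] at hcard
  -- Node `b` is itself a zero, so the count is positive.
  have h' : ∃ δ, Oscillates f
      (((Finset.Ioc a b).filter (fun i => f (lam i) = 0)).card + 1) u δ := by
    refine h.resolve_left (Finset.card_ne_zero_of_mem (a := b) ?_)
    simp only [Finset.mem_filter, Finset.mem_Ioc]
    exact ⟨⟨hab, le_rfl⟩, hb _ ⟨le_rfl, hl.monotone (by omega)⟩⟩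
  obtain ⟨δ, ho⟩ := h'
  obtain ⟨h1, h2⟩ := hf.increment_alternates_of_oscillates hl hcov ha
    (fun i hi => hf.iteratedDeriv_eq_zero_of_tile hl hb hi) ho hu
  push_cast at h1 h2
  simp only [ne_eq]
  exact ⟨by omega, fun e => h2 (by omega)⟩

end IsSpline

/-! ### Truncated powers -/

theorem hasDerivAt_max_zero_pow (k : ℕ) (x : ℝ) :
    HasDerivAt (fun x : ℝ => max x 0 ^ (k + 2)) ((k + 2 : ℕ) * max x 0 ^ (k + 1)) x := by
  rcases lt_trichotomy x 0 with h | rfl | h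
  · have h1 : (fun x : ℝ => max x 0 ^ (k + 2)) =ᶠ[nhds x] fun _ => 0 := by
      filter_upwards [isOpen_Iio.mem_nhds h] with y hy
      rw [max_eq_right (le_of_lt hy)]; simp
    rw [max_eq_right h.le, zero_pow (by omega), mul_zero]
    exact (hasDerivAt_const x (0 : ℝ)).congr_of_eventuallyEq h1
  · rw [max_self, zero_pow (by omega), mul_zero, hasDerivAt_iff_hasFDerivAt]
    have : (fun x : ℝ => max x 0 ^ (k + 2)) =O[nhds 0] fun x => ‖x - 0‖ ^ (k + 2) := by
      refine Asymptotics.isBigO_of_le _ fun x => ?_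
      rw [sub_zero, norm_pow, norm_pow, norm_norm]
      refine pow_le_pow_left₀ (norm_nonneg _) ?_ _
      rw [Real.norm_eq_abs, Real.norm_eq_abs, abs_of_nonneg (le_max_right _ _)]
      exact max_le (le_abs_self x) (abs_nonneg x)
    simpa using this.hasFDerivAt (by omega)
  · have h1 : (fun x : ℝ => max x 0 ^ (k + 2)) =ᶠ[nhds x] fun x => x ^ (k + 2) := by
      filter_upwards [isOpen_Ioi.mem_nhds h] with y hy
      rw [max_eq_left (le_of_lt hy)]
    rw [max_eq_left h.le]
    exact (hasDerivAt_pow (k + 2) x).congr_of_eventuallyEq h1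

theorem contDiff_max_zero_pow (q : ℕ) : ContDiff ℝ q (fun x : ℝ => max x 0 ^ (q + 1)) := by
  induction q with
  | zero =>
    refine contDiff_zero.2 ?_
    fun_prop
  | succ q ih =>
    push_cast
    refine contDiff_succ_iff_deriv.2 ⟨fun x => (hasDerivAt_max_zero_pow q x).differentiableAt,
      by simp, ?_⟩
    have : deriv (fun x : ℝ => max x 0 ^ (q + 2)) =
        fun x => ((q + 2 : ℕ) : ℝ) * max x 0 ^ (q + 1) :=
      funext fun x => (hasDerivAt_max_zero_pow q x).deriv
    rw [this]
    exact contDiff_const.mul ih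

/-! ### Windows: existence and uniqueness -/

/-- The open window `(a, b)` contains exactly `q + 1` indices outside `Z`, and it cannot be
shortened at either end. -/
structure IsWindow (Z : Set ℤ) (q : ℕ) (a b : ℤ) : Prop where
  first : a + 1 ∉ Z
  last : b - 1 ∉ Z
  ncard : (Ioo a b \ Z).ncard = q + 1

theorem IsWindow.add_one_lt {Z : Set ℤ} {q : ℕ} {a b : ℤ} (h : IsWindow Z q a b) :
    a + 1 < b := by
  by_contra! hle
  have : Ioo a b = ∅ := by ext i; simp; omega
  have h2 := h.ncard
  simp [this] at h2

namespace IsSpline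

-- The `b - a + 1` truncated powers at the nodes of `[a, b]` vanish left of `lam a`. Vanishing right
-- of `lam b` costs `q + 2` linear conditions and vanishing on `Z` costs `b - a - 1 - (q + 1)`:
-- together one fewer than the number of coefficients.
open Polynomial in
theorem exists_ne_zero {lam : ℤ → ℝ} {q : ℕ} (hl : StrictMono lam) {Z : Set ℤ} {a b : ℤ}
    (hab : a ≤ b) (hZ : (Ioo a b \ Z).ncard = q + 1) :
    ∃ f, IsSpline lam q f ∧ (∀ j ∈ Ioo a b ∩ Z, f (lam j) = 0) ∧ (∀ x ≤ lam a, f x = 0) ∧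
      (∀ x, lam b ≤ x → f x = 0) ∧ ∃ x, f x ≠ 0 := by
  classical
  let zs := (Finset.Ioo a b).filter (· ∈ Z)
  have hzs : zs.card + (q + 1) = (b - a - 1).toNat := by
    have h1 : ((Finset.Ioo a b).filter (· ∉ Z)).card = q + 1 := by
      rw [← hZ, ← Set.ncard_coe_finset]
      congr 1
      ext i; simp
    rw [← h1, ← Int.card_Ioo]
    exact Finset.card_filter_add_card_filter_not _
  have hq : q + 2 ≤ (b - a).toNat := by omega
  -- First component: the polynomial that the truncated power becomes right of `lam b`. Second
  -- component: its values at the prescribed zeros.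
  let v : Finset.Icc a b → degreeLT ℝ (q + 2) × (zs → ℝ) := fun i =>
    (⟨(X - C (lam i)) ^ (q + 1), by
      rw [mem_degreeLT, degree_pow, degree_X_sub_C, nsmul_one]; norm_cast; omega⟩,
      fun j => max (lam j - lam i) 0 ^ (q + 1))
  have hdep : ¬ LinearIndependent ℝ v := by
    intro h
    have h1 := h.fintype_card_le_finrank
    rw [Module.finrank_prod, (degreeLTEquiv ℝ (q + 2)).finrank_eq] at h1
    simp only [Module.finrank_fintype_fun_eq_card, Fintype.card_fin, Fintype.card_coe,
      Int.card_Icc] at h1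
    omega
  obtain ⟨c, hc, hc0⟩ := Fintype.not_linearIndependent_iff.1 hdep
  have hc1 : ∑ i, C (c i) * (X - C (lam i)) ^ (q + 1) = 0 := by
    have := congrArg (fun w => (w.1 : ℝ[X])) hc
    simpa [v, Prod.fst_sum, smul_eq_C_mul] using this
  have hc2 : ∀ j ∈ zs, ∑ i, c i * max (lam j - lam i) 0 ^ (q + 1) = 0 := by
    intro j hj
    have := congrArg (fun w => w.2 ⟨j, hj⟩) hc
    simpa [v, Prod.snd_sum] using this
  refine ⟨fun x => ∑ i, c i * max (x - lam i) 0 ^ (q + 1), ⟨?_, fun n => ?_⟩, ?_, ?_, ?_, ?_⟩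
  · refine ContDiff.sum fun i _ => contDiff_const.mul ?_
    exact (contDiff_max_zero_pow q).comp (contDiff_id.sub contDiff_const)
  · refine ⟨∑ i : Finset.Icc a b, if (i : ℤ) ≤ n then C (c i) * (X - C (lam i)) ^ (q + 1) else 0,
      ?_, fun x hx => ?_⟩
    · rw [← mem_degreeLT]
      refine Submodule.sum_mem _ fun i _ => ?_
      split_ifs
      · rw [← smul_eq_C_mul]
        exact Submodule.smul_mem _ _ (v i).1.2
      · exact Submodule.zero_mem _
    · rw [eval_finsetSum]
      refine Finset.sum_congr rfl fun i _ => ?_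
      split_ifs with h
      · rw [max_eq_left (sub_nonneg.2 ((hl.monotone h).trans hx.1))]
        simp
      · rw [max_eq_right (sub_nonpos.2 (hx.2.trans (hl.monotone (by omega))))]
        simp
  · intro j hj
    exact hc2 j (by simpa [zs] using hj)
  · intro x hx
    refine Finset.sum_eq_zero fun i _ => ?_
    rw [max_eq_right (sub_nonpos.2 (hx.trans (hl.monotone (Finset.mem_Icc.1 i.2).1)))]
    simp
  · intro x hx
    have := congrArg (eval x) hc1
    rw [eval_finsetSum, eval_zero] at this
    refine Eq.trans (Finset.sum_congr rfl fun i _ => ?_) this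
    rw [max_eq_left (sub_nonneg.2 ((hl.monotone (Finset.mem_Icc.1 i.2).2).trans hx))]
    simp
  · obtain ⟨i, hi, hmin⟩ := Finset.exists_min_image (Finset.univ.filter fun i => c i ≠ 0)
      (fun i => (i : ℤ)) (by simpa [Finset.Nonempty] using hc0)
    rw [Finset.mem_filter] at hi
    refine ⟨lam (i + 1), ?_⟩
    beta_reduce
    rw [Finset.sum_eq_single i]
    · have : 0 < lam (i + 1) - lam i := sub_pos.2 (hl (by omega))
      rw [max_eq_left this.le]
      exact mul_ne_zero hi.2 (pow_ne_zero _ this.ne')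
    · intro j _ hji
      by_cases hj : c j = 0
      · simp [hj]
      · have h1 := hmin j (by simpa using hj)
        have h2 : (j : ℤ) ≠ i := fun h => hji (Subtype.ext h)
        rw [max_eq_right (sub_nonpos.2 (hl.monotone (by omega)))]
        simp
    · simp

variable {lam : ℤ → ℝ} {q : ℕ} {f : ℝ → ℝ}

/-- Together with `exists_first_tile` this isolates a block of tiles to which the zero count
applies. -/
theorem exists_zero_tile (hl : StrictMono lam) {a c : ℤ}
    (ha : ∃ x ∈ Icc (lam a) (lam (a + 1)), f x ≠ 0) (hc : ∀ x, lam c ≤ x → f x = 0) :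
    ∃ b, a < b ∧ b ≤ c ∧ (∀ j, a ≤ j → j < b → ∃ x ∈ Icc (lam j) (lam (j + 1)), f x ≠ 0) ∧
      ∀ x ∈ Icc (lam b) (lam (b + 1)), f x = 0 := by
  have hac : a < c := by
    by_contra! hle
    obtain ⟨x, hx, hx0⟩ := ha
    exact hx0 (hc x ((hl.monotone hle).trans hx.1))
  obtain ⟨b, ⟨h1, h2⟩, h3⟩ := Int.exists_least_of_bdd
    (P := fun b => a < b ∧ ∀ x ∈ Icc (lam b) (lam (b + 1)), f x = 0)
    ⟨a, fun z hz => hz.1.le⟩ ⟨c, hac, fun x hx => hc x hx.1⟩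
  refine ⟨b, h1, h3 c ⟨hac, fun x hx => hc x hx.1⟩, fun j hj hjb => ?_, h2⟩
  rcases hj.eq_or_lt with rfl | hj
  · exact ha
  · by_contra! hno
    have := h3 j ⟨hj, hno⟩
    omega

theorem exists_first_tile (hl : StrictMono lam) (hcov : ∀ x, ∃ j, lam j ≤ x ∧ x < lam (j + 1))
    {a : ℤ} (ha : ∀ x ≤ lam a, f x = 0) (hne : ∃ x, f x ≠ 0) :
    ∃ a', a ≤ a' ∧ (∃ x ∈ Icc (lam a') (lam (a' + 1)), f x ≠ 0) ∧ ∀ x ≤ lam a', f x = 0 := by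
  have hbd : ∀ z, (∃ x ∈ Icc (lam z) (lam (z + 1)), f x ≠ 0) → a ≤ z := by
    rintro z ⟨x, hx, hx0⟩
    by_contra! hz
    exact hx0 (ha x (hx.2.trans (hl.monotone (by omega))))
  obtain ⟨x, hx⟩ := hne
  obtain ⟨j, hj, hj'⟩ := hcov x
  obtain ⟨a', h1, h2⟩ := Int.exists_least_of_bdd
    (P := fun z => ∃ x ∈ Icc (lam z) (lam (z + 1)), f x ≠ 0) ⟨a, hbd⟩ ⟨j, x, ⟨hj, hj'.le⟩, hx⟩
  refine ⟨a', hbd a' h1, h1, fun y hy => ?_⟩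
  by_contra hy0
  rcases hy.eq_or_lt with rfl | hy
  · have := h2 (a' - 1) ⟨_, ⟨hl.monotone (by omega), by rw [sub_add_cancel]⟩, hy0⟩
    omega
  · obtain ⟨i, hi, hi'⟩ := hcov y
    have h3 := h2 i ⟨y, ⟨hi, hi'.le⟩, hy0⟩
    have h4 : i < a' := hl.lt_iff_lt.1 (hi.trans_lt hy)
    omega

variable {Z : Set ℤ} {a b : ℤ}

/-- With one of the `q + 1` free nodes a zero too, at most `q` nodes are left, too few for a nonzero
spline. -/
theorem eq_zero_of_window (hl : StrictMono lam)
    (hcov : ∀ x, ∃ j, lam j ≤ x ∧ x < lam (j + 1)) (hw : IsWindow Z q a b)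
    (hf : IsSpline lam q f) (hZ : ∀ j ∈ Z, f (lam j) = 0) (ha : ∀ x ≤ lam a, f x = 0)
    (hb : ∀ x, lam b ≤ x → f x = 0) (h1 : f (lam (a + 1)) = 0) (x : ℝ) : f x = 0 := by
  by_contra hx
  obtain ⟨a', haa', hne, ha'⟩ := exists_first_tile hl hcov ha ⟨x, hx⟩
  obtain ⟨b', hab', hbb', hne', hb'⟩ := exists_zero_tile hl hne hb
  have h2 := (hf.le_card_ne_zero hl hcov hab' ha' hne' hb').1
  rw [← Set.ncard_coe_finset] at h2
  have hfin : (Ioo a b \ Z).Finite := (finite_Ioo a b).subset sdiff_subset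
  have hlt := hw.add_one_lt
  have h3 : (((Finset.Ioc a' b').filter (fun i => f (lam i) ≠ 0) : Finset ℤ) : Set ℤ) ⊆
      (Ioo a b \ Z) \ {a + 1} := by
    intro i hi
    simp only [ne_eq, Finset.coe_filter, Finset.mem_Ioc, mem_ofPred_eq] at hi
    have hib : i < b := by
      by_contra! hle
      exact hi.2 (hb _ (hl.monotone hle))
    refine ⟨⟨⟨by omega, hib⟩, fun hiZ => hi.2 (hZ i hiZ)⟩, ?_⟩
    rintro rfl
    exact hi.2 h1
  have h4 := Set.ncard_le_ncard h3 (hfin.subset sdiff_subset)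
  have h5 := Set.ncard_sdiff_singleton_add_one (s := Ioo a b \ Z) (a := a + 1)
    ⟨⟨by omega, hlt⟩, hw.first⟩ hfin
  have := hw.ncard
  omega

/-- A zero tile before `b` would make the free node `b - 1` useless and leave at most `q` nonzero
nodes. The right end `c` is arbitrary, so this applies to every compactly supported competitor. -/
theorem ne_zero_on_window (hl : StrictMono lam)
    (hcov : ∀ x, ∃ j, lam j ≤ x ∧ x < lam (j + 1)) (hw : IsWindow Z q a b)
    (hf : IsSpline lam q f) (hZ : ∀ j ∈ Z, f (lam j) = 0) (ha : ∀ x ≤ lam a, f x = 0) {c : ℤ}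
    (hc : ∀ x, lam c ≤ x → f x = 0) (h1 : f (lam (a + 1)) ≠ 0) :
    ∃ b', b ≤ b' ∧ b' ≤ c ∧
      (∀ j, a ≤ j → j < b' → ∃ x ∈ Icc (lam j) (lam (j + 1)), f x ≠ 0) ∧
      ∀ x ∈ Icc (lam b') (lam (b' + 1)), f x = 0 := by
  obtain ⟨b', hab', hbc, hne', hb'⟩ :=
    exists_zero_tile hl ⟨_, ⟨hl.monotone (by omega), le_rfl⟩, h1⟩ hc
  refine ⟨b', ?_, hbc, hne', hb'⟩
  by_contra! hlt
  have h2 := (hf.le_card_ne_zero hl hcov hab' ha hne' hb').1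
  rw [← Set.ncard_coe_finset] at h2
  have hfin : (Ioo a b \ Z).Finite := (finite_Ioo a b).subset sdiff_subset
  have hab := hw.add_one_lt
  have h3 : (((Finset.Ioc a b').filter (fun i => f (lam i) ≠ 0) : Finset ℤ) : Set ℤ) ⊆
      (Ioo a b \ Z) \ {b - 1} := by
    intro i hi
    simp only [ne_eq, Finset.coe_filter, Finset.mem_Ioc, mem_ofPred_eq] at hi
    have hib : i ≠ b' := by
      rintro rfl
      exact hi.2 (hb' _ ⟨le_rfl, hl.monotone (by omega)⟩)
    exact ⟨⟨⟨by omega, by omega⟩, fun hiZ => hi.2 (hZ i hiZ)⟩, by simp; omega⟩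
  have h4 := Set.ncard_le_ncard h3 (hfin.subset sdiff_subset)
  have h5 := Set.ncard_sdiff_singleton_add_one (s := Ioo a b \ Z) (a := b - 1)
    ⟨⟨by omega, by omega⟩, hw.last⟩ hfin
  have := hw.ncard
  omega

end IsSpline

/-! ### The spline of a window -/

/-- The splines of order `q + 2` attached to a window: they vanish outside `[lam a, lam b]` and on
`Z`, and they are normalized at `lam (a + 1)`. -/
structure IsWindowSpline (lam : ℤ → ℝ) (Z : Set ℤ) (q : ℕ) (a b : ℤ) (f : ℝ → ℝ) : Prop where
  isSpline : IsSpline lam q f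
  zero : ∀ j ∈ Z, f (lam j) = 0
  left : ∀ x ≤ lam a, f x = 0
  right : ∀ x, lam b ≤ x → f x = 0
  one : f (lam (a + 1)) = 1

namespace IsWindowSpline

variable {lam : ℤ → ℝ} {q : ℕ} {f : ℝ → ℝ} {Z : Set ℤ} {a b : ℤ}

theorem exists_of_window (hl : StrictMono lam)
    (hcov : ∀ x, ∃ j, lam j ≤ x ∧ x < lam (j + 1)) (hw : IsWindow Z q a b) :
    ∃ f, IsWindowSpline lam Z q a b f := by
  obtain ⟨f, hf, h1, h2, h3, x, hx⟩ := IsSpline.exists_ne_zero hl (Z := Z)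
    (by have := hw.add_one_lt; omega) hw.ncard
  have hZ : ∀ j ∈ Z, f (lam j) = 0 := by
    intro j hj
    rcases le_or_gt j a with h | h
    · exact h2 _ (hl.monotone h)
    rcases le_or_gt b j with h' | h'
    · exact h3 _ (hl.monotone h')
    exact h1 j ⟨⟨h, h'⟩, hj⟩
  have h0 : f (lam (a + 1)) ≠ 0 := fun h0 => hx (hf.eq_zero_of_window hl hcov hw hZ h2 h3 h0 x)
  refine ⟨fun x => (f (lam (a + 1)))⁻¹ * f x, hf.const_mul _, fun j hj => ?_, fun x hx => ?_,
    fun x hx => ?_, inv_mul_cancel₀ h0⟩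
  · rw [hZ j hj, mul_zero]
  · rw [h2 x hx, mul_zero]
  · rw [h3 x hx, mul_zero]

theorem eq_mul (hl : StrictMono lam) (hcov : ∀ x, ∃ j, lam j ≤ x ∧ x < lam (j + 1))
    (hw : IsWindow Z q a b) (hf : IsWindowSpline lam Z q a b f) {g : ℝ → ℝ}
    (hg : IsSpline lam q g) (hZ : ∀ j ∈ Z, g (lam j) = 0) (ha : ∀ x ≤ lam a, g x = 0)
    (hb : ∀ x, lam b ≤ x → g x = 0) (x : ℝ) : g x = g (lam (a + 1)) * f x := by
  have := (hg.sub (hf.isSpline.const_mul (g (lam (a + 1))))).eq_zero_of_window hl hcov hw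
    (fun j hj => by rw [hZ j hj, hf.zero j hj]; simp)
    (fun x hx => by rw [ha x hx, hf.left x hx]; simp)
    (fun x hx => by rw [hb x hx, hf.right x hx]; simp)
    (by rw [hf.one]; simp) x
  linarith

theorem unique (hl : StrictMono lam) (hcov : ∀ x, ∃ j, lam j ≤ x ∧ x < lam (j + 1))
    (hw : IsWindow Z q a b) (hf : IsWindowSpline lam Z q a b f) {g : ℝ → ℝ}
    (hg : IsWindowSpline lam Z q a b g) : g = f := by
  funext x
  rw [eq_mul hl hcov hw hf hg.isSpline hg.zero hg.left hg.right, hg.one, one_mul]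

/-- Only the `q + 1` free nodes can be nonzero, so the zero count holds with equality. -/
theorem increment_ne_zero (hl : StrictMono lam)
    (hcov : ∀ x, ∃ j, lam j ≤ x ∧ x < lam (j + 1)) (hw : IsWindow Z q a b)
    (hf : IsWindowSpline lam Z q a b f) :
    (∀ i, a ≤ i → i < b → IsSpline.increment lam q f i ≠ 0) ∧
      ∀ i, a ≤ i → i + 1 < b →
        IsSpline.increment lam q f i * IsSpline.increment lam q f (i + 1) < 0 := by
  obtain ⟨b', h1, h2, h3, h4⟩ := hf.isSpline.ne_zero_on_window hl hcov hw hf.zero hf.left hf.right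
    (by rw [hf.one]; exact one_ne_zero)
  obtain rfl : b' = b := by omega
  have hab := hw.add_one_lt
  obtain ⟨h5, h6⟩ := hf.isSpline.le_card_ne_zero hl hcov (by omega) hf.left h3 h4
  refine h6 (le_antisymm ?_ h5)
  rw [← hw.ncard, ← Set.ncard_coe_finset]
  refine Set.ncard_le_ncard (fun i hi => ?_) ((finite_Ioo a b').subset sdiff_subset)
  simp only [ne_eq, Finset.coe_filter, Finset.mem_Ioc, mem_ofPred_eq] at hi
  have hib : i ≠ b' := by
    rintro rfl
    exact hi.2 (hf.right _ le_rfl)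
  exact ⟨⟨by omega, by omega⟩, fun hiZ => hi.2 (hf.zero i hiZ)⟩

end IsWindowSpline

/-! ### Recovering the nodes from the shape -/

theorem iteratedDeriv_eval (P : Polynomial ℝ) (i : ℕ) :
    iteratedDeriv i (fun x => P.eval x) = fun x => (Polynomial.derivative^[i] P).eval x := by
  induction i generalizing P with
  | zero => simp
  | succ i ih =>
    rw [iteratedDeriv_succ', Function.iterate_succ_apply, ← ih]
    congr 1
    ext x
    exact P.deriv

theorem iteratedDeriv_sub_iteratedDeriv {i q : ℕ} (hi : i ≤ q) (f : ℝ → ℝ) :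
    iteratedDeriv (q - i) (iteratedDeriv i f) = iteratedDeriv q f := by
  simp only [iteratedDeriv_eq_iterate]
  rw [← Function.iterate_add_apply, Nat.sub_add_cancel hi]

/-- The points near which `g` is not a polynomial. -/
def nonpolynomialSet (g : ℝ → ℝ) : Set ℝ :=
  {x | ¬ ∃ P : Polynomial ℝ, g =ᶠ[nhds x] fun y => P.eval y}

theorem mem_nonpolynomialSet_mul_comp_add {g : ℝ → ℝ} {r d x : ℝ} (hr : r ≠ 0) :
    x ∈ nonpolynomialSet (fun x => r * g (x + d)) ↔ x + d ∈ nonpolynomialSet g := by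
  have key : ∀ {g : ℝ → ℝ} {r d x : ℝ}, (∃ P : Polynomial ℝ, g =ᶠ[nhds (x + d)] fun y => P.eval y) →
      ∃ P : Polynomial ℝ, (fun x => r * g (x + d)) =ᶠ[nhds x] fun y => P.eval y := by
    rintro g r d x ⟨P, hP⟩
    refine ⟨Polynomial.C r * Polynomial.taylor d P, ?_⟩
    have ht : Filter.Tendsto (fun y => y + d) (nhds x) (nhds (x + d)) :=
      (continuous_id.add continuous_const).continuousAt
    filter_upwards [ht.eventually hP] with y hy
    rw [hy, Polynomial.eval_mul, Polynomial.eval_C, Polynomial.taylor_eval]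
  refine not_congr ⟨fun h => ?_, key⟩
  have h1 : ∃ P : Polynomial ℝ, (fun x => r * g (x + d)) =ᶠ[nhds (x + d + -d)]
      fun y => P.eval y := by simpa using h
  have h2 := key (r := r⁻¹) h1
  simpa [hr] using h2

theorem image_Iic_inj {t t' : ℕ → ℝ} (ht : StrictMono t) (ht' : StrictMono t') {N N' : ℕ}
    (h : t '' Iic N = t' '' Iic N') : N = N' ∧ ∀ k ≤ N, t k = t' k := by
  have h1 := congrArg Set.ncard h
  rw [Set.ncard_image_of_injective _ ht.injective, Set.ncard_image_of_injective _ ht'.injective,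
    ← Finset.coe_Iic, ← Finset.coe_Iic, Set.ncard_coe_finset, Set.ncard_coe_finset,
    Nat.card_Iic, Nat.card_Iic] at h1
  obtain rfl : N = N' := by omega
  have hr : ∀ u : ℕ → ℝ, range (fun k : Fin (N + 1) => u k) = u '' Iic N := by
    intro u
    ext x
    constructor
    · rintro ⟨k, rfl⟩
      exact ⟨k, Nat.le_of_lt_succ k.2, rfl⟩
    · rintro ⟨k, hk, rfl⟩
      exact ⟨⟨k, Nat.lt_succ_of_le hk⟩, rfl⟩
  have h2 : (fun k : Fin (N + 1) => t k) = fun k : Fin (N + 1) => t' k := by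
    refine (StrictMono.range_inj (f := fun k : Fin (N + 1) => t k)
      (g := fun k : Fin (N + 1) => t' k) (fun i j hij => ht hij) (fun i j hij => ht' hij)).1 ?_
    rw [hr, hr, h]
  exact ⟨rfl, fun k hk => congrFun h2 ⟨k, Nat.lt_succ_of_le hk⟩⟩

namespace IsWindowSpline

variable {lam : ℤ → ℝ} {q : ℕ} {f : ℝ → ℝ} {Z : Set ℤ} {a b : ℤ}

/-- Outside its window the spline is zero, so the two chains need to agree only inside. -/
theorem translate (hl : StrictMono lam) (hf : IsWindowSpline lam Z q a b f) {a' b' : ℤ}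
    (hab : a + 1 < b) (hb : b - a = b' - a')
    (hlam : ∀ k, 0 ≤ k → k ≤ b - a → lam (a' + k) - lam a' = lam (a + k) - lam a)
    (hZ : ∀ k, 0 < k → k < b - a → a' + k ∈ Z → a + k ∈ Z) :
    IsWindowSpline lam Z q a' b' (fun x => f (x + (lam a - lam a'))) := by
  have hb' := hlam (b - a) (by omega) le_rfl
  rw [add_sub_cancel, hb, add_sub_cancel] at hb'
  have hleft : ∀ x ≤ lam a', f (x + (lam a - lam a')) = 0 := fun x hx => hf.left _ (by linarith)
  have hright : ∀ x, lam b' ≤ x → f (x + (lam a - lam a')) = 0 :=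
    fun x hx => hf.right _ (by linarith)
  refine ⟨⟨hf.isSpline.contDiff.comp (contDiff_id.add contDiff_const), fun n => ?_⟩, fun j hj => ?_,
    hleft, hright, ?_⟩
  · rcases lt_or_ge n a' with h | h
    · refine ⟨0, by rw [Polynomial.degree_zero]; exact WithBot.bot_lt_coe _, fun x hx => ?_⟩
      rw [hleft x (hx.2.trans (hl.monotone (by omega))), Polynomial.eval_zero]
    rcases le_or_gt b' n with h' | h'
    · refine ⟨0, by rw [Polynomial.degree_zero]; exact WithBot.bot_lt_coe _, fun x hx => ?_⟩
      rw [hright x ((hl.monotone h').trans hx.1), Polynomial.eval_zero]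
    obtain ⟨P, hP, hPf⟩ := hf.isSpline.piece (a + (n - a'))
    refine ⟨Polynomial.taylor (lam a - lam a') P, by rwa [Polynomial.degree_taylor],
      fun x hx => ?_⟩
    rw [Polynomial.taylor_eval]
    have h1 := hlam (n - a') (by omega) (by omega)
    have h2 := hlam (n - a' + 1) (by omega) (by omega)
    rw [show a' + (n - a') = n by ring] at h1
    rw [show a' + (n - a' + 1) = n + 1 by ring, ← add_assoc] at h2
    exact hPf _ ⟨by linarith [hx.1], by linarith [hx.2]⟩
  · rcases le_or_gt j a' with h | h
    · exact hleft _ (hl.monotone h)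
    rcases le_or_gt b' j with h' | h'
    · exact hright _ (hl.monotone h')
    have h1 := hlam (j - a') (by omega) (by omega)
    have h2 := hZ (j - a') (by omega) (by omega)
    rw [show a' + (j - a') = j by ring] at h1 h2
    rw [show lam j + (lam a - lam a') = lam (a + (j - a')) by linarith]
    exact hf.zero _ (h2 hj)
  · have h1 := hlam 1 (by omega) (by omega)
    rw [show lam (a' + 1) + (lam a - lam a') = lam (a + 1) by linarith, hf.one]

theorem iteratedDeriv_left (hf : IsWindowSpline lam Z q a b f) {i : ℕ} (hi : i ≤ q) :
    ∀ x ≤ lam a, iteratedDeriv i f x = 0 :=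
  hf.isSpline.iteratedDeriv_eq_zero_of_le hf.left hi

theorem iteratedDeriv_right (hf : IsWindowSpline lam Z q a b f) {i : ℕ} (hi : i ≤ q) :
    ∀ x, lam b ≤ x → iteratedDeriv i f x = 0 := by
  intro x hx
  have := eqOn_iteratedDeriv_zero hf.isSpline.contDiff hi (isOpen_Ioi (a := lam b))
    (fun y hy => hf.right y (le_of_lt hy))
  rw [closure_Ioi] at this
  exact this hx

theorem affine_piece (hl : StrictMono lam) (hf : IsWindowSpline lam Z q a b f) (n : ℤ) :
    ∃ c d : ℝ, (∀ x ∈ Icc (lam n) (lam (n + 1)), iteratedDeriv q f x = c * x + d) ∧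
      IsSpline.increment lam q f n = c * (lam (n + 1) - lam n) := by
  have h := hf.isSpline
  rw [← zero_add q] at h
  exact (h.iteratedDeriv hl).affine_piece hl n

/-- If the derivative of order `i` vanished near a point inside a tile of the window, so would that
of order `q`, against its nonzero slope there. -/
theorem tsupport_iteratedDeriv (hl : StrictMono lam)
    (hcov : ∀ x, ∃ j, lam j ≤ x ∧ x < lam (j + 1)) (hw : IsWindow Z q a b)
    (hf : IsWindowSpline lam Z q a b f) {i : ℕ} (hi : i ≤ q) :
    tsupport (iteratedDeriv i f) = Icc (lam a) (lam b) := by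
  have hab := hw.add_one_lt
  apply Subset.antisymm
  · refine closure_minimal (fun x hx => ?_) isClosed_Icc
    by_contra hno
    rw [mem_Icc, not_and_or, not_le, not_le] at hno
    rcases hno with h | h
    · exact hx (hf.iteratedDeriv_left hi x h.le)
    · exact hx (hf.iteratedDeriv_right hi x h.le)
  · have tile : ∀ j, a ≤ j → j < b → Icc (lam j) (lam (j + 1)) ⊆ tsupport (iteratedDeriv i f) := by
      intro j hj hjb
      have hlt : lam j < lam (j + 1) := hl (by omega)
      rw [← closure_Ioo hlt.ne]
      refine closure_minimal (fun x hx => ?_) (isClosed_tsupport _)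
      by_contra hno
      rw [notMem_tsupport_iff_eventuallyEq] at hno
      have h1 := hno.iteratedDeriv (q - i)
      rw [iteratedDeriv_sub_iteratedDeriv hi] at h1
      obtain ⟨c, d, hcd, hinc⟩ := hf.affine_piece hl j
      have h2 : (fun y => c * y + d) =ᶠ[nhds x] fun _ => 0 := by
        filter_upwards [h1, isOpen_Ioo.mem_nhds hx] with y hy hy'
        rw [← hcd y (Ioo_subset_Icc_self hy'), hy]
        rw [show (0 : ℝ → ℝ) = fun _ => 0 from rfl]
        simp
      have h3 := h2.deriv_eq
      have h4 : c = 0 := by simpa using h3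
      exact (increment_ne_zero hl hcov hw hf).1 j hj hjb (by rw [hinc, h4, zero_mul])
    intro x hx
    rcases hx.2.eq_or_lt with rfl | hxb
    · have := tile (b - 1) (by omega) (by omega)
      rw [sub_add_cancel] at this
      exact this ⟨hl.monotone (by omega), le_rfl⟩
    · obtain ⟨j, hj, hj'⟩ := hcov x
      have h1 : a < j + 1 := hl.lt_iff_lt.1 (hx.1.trans_lt hj')
      have h2 : j < b := hl.lt_iff_lt.1 (hj.trans_lt hxb)
      exact tile j (by omega) h2 ⟨hj, hj'.le⟩

/-- Where the derivative is locally polynomial, the slopes of the derivative of order `q` agree on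
both sides. At an inner node they have opposite signs; at an end of the window exactly one of them
is zero. -/
theorem nonpolynomialSet_iteratedDeriv (hl : StrictMono lam)
    (hcov : ∀ x, ∃ j, lam j ≤ x ∧ x < lam (j + 1)) (hw : IsWindow Z q a b)
    (hf : IsWindowSpline lam Z q a b f) {i : ℕ} (hi : i ≤ q) :
    nonpolynomialSet (iteratedDeriv i f) = lam '' Icc a b := by
  have hab := hw.add_one_lt
  apply Subset.antisymm
  · intro x hx
    by_contra hno
    apply hx
    have zero : ∀ U, IsOpen U → x ∈ U → (∀ y ∈ U, iteratedDeriv i f y = 0) →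
        ∃ P : Polynomial ℝ, iteratedDeriv i f =ᶠ[nhds x] fun y => P.eval y := by
      intro U hU hxU h
      refine ⟨0, ?_⟩
      filter_upwards [hU.mem_nhds hxU] with y hy
      rw [h y hy, Polynomial.eval_zero]
    rcases lt_or_ge x (lam a) with h | h
    · exact zero _ isOpen_Iio h fun y hy => hf.iteratedDeriv_left hi y (le_of_lt hy)
    rcases lt_or_ge (lam b) x with h' | h'
    · exact zero _ isOpen_Ioi h' fun y hy => hf.iteratedDeriv_right hi y (le_of_lt hy)
    obtain ⟨j, hj, hj'⟩ := hcov x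
    have h1 : a < j + 1 := hl.lt_iff_lt.1 (h.trans_lt hj')
    have h2 : j ≤ b := hl.le_iff_le.1 (hj.trans h')
    have h3 : lam j < x := lt_of_le_of_ne hj fun e => hno ⟨j, ⟨by omega, h2⟩, e⟩
    obtain ⟨P, -, hP⟩ := hf.isSpline.piece j
    have h4 : f =ᶠ[nhds x] fun y => P.eval y :=
      Filter.eventuallyEq_of_mem (isOpen_Ioo.mem_nhds ⟨h3, hj'⟩)
        fun y hy => hP y (Ioo_subset_Icc_self hy)
    refine ⟨Polynomial.derivative^[i] P, ?_⟩
    rw [← iteratedDeriv_eval]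
    exact h4.iteratedDeriv i
  · rintro _ ⟨j, ⟨hj, hjb⟩, rfl⟩ ⟨P, hP⟩
    have h1 := hP.iteratedDeriv (q - i)
    rw [iteratedDeriv_sub_iteratedDeriv hi, iteratedDeriv_eval] at h1
    set Q := Polynomial.derivative^[q - i] P
    have hlt1 : lam (j - 1) < lam j := hl (by omega)
    have hlt2 : lam j < lam (j + 1) := hl (by omega)
    obtain ⟨c, d, hcd, hinc⟩ := hf.affine_piece hl (j - 1)
    obtain ⟨c', d', hcd', hinc'⟩ := hf.affine_piece hl j
    rw [sub_add_cancel] at hcd hinc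
    have hc : c = Q.derivative.eval (lam j) := by
      have h2 : (fun y => c * y + d) =ᶠ[nhdsWithin (lam j) (Iio (lam j))] fun y => Q.eval y := by
        filter_upwards [h1.filter_mono nhdsWithin_le_nhds, Ioo_mem_nhdsLT hlt1] with y hy hy'
        rw [← hy, hcd y (Ioo_subset_Icc_self hy')]
      have h3 : HasDerivWithinAt (fun y => c * y + d) c (Iio (lam j)) (lam j) := by
        simpa using (((hasDerivAt_id (lam j)).const_mul c).add_const d).hasDerivWithinAt
      have h4 : HasDerivWithinAt (fun y => c * y + d) (Q.derivative.eval (lam j)) (Iio (lam j))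
          (lam j) := by
        refine (Q.hasDerivAt (lam j)).hasDerivWithinAt.congr_of_eventuallyEq h2 ?_
        rw [← hcd _ ⟨hlt1.le, le_rfl⟩, h1.eq_of_nhds]
      exact (uniqueDiffWithinAt_Iio (lam j)).eq_deriv _ h3 h4
    have hc' : c' = Q.derivative.eval (lam j) := by
      have h2 : (fun y => c' * y + d') =ᶠ[nhdsWithin (lam j) (Ioi (lam j))] fun y => Q.eval y := by
        filter_upwards [h1.filter_mono nhdsWithin_le_nhds, Ioo_mem_nhdsGT hlt2] with y hy hy'
        rw [← hy, hcd' y (Ioo_subset_Icc_self hy')]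
      have h3 : HasDerivWithinAt (fun y => c' * y + d') c' (Ioi (lam j)) (lam j) := by
        simpa using (((hasDerivAt_id (lam j)).const_mul c').add_const d').hasDerivWithinAt
      have h4 : HasDerivWithinAt (fun y => c' * y + d') (Q.derivative.eval (lam j)) (Ioi (lam j))
          (lam j) := by
        refine (Q.hasDerivAt (lam j)).hasDerivWithinAt.congr_of_eventuallyEq h2 ?_
        rw [← hcd' _ ⟨le_rfl, hlt2.le⟩, h1.eq_of_nhds]
      exact (uniqueDiffWithinAt_Ioi (lam j)).eq_deriv _ h3 h4
    rw [← hc] at hc'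
    subst hc'
    obtain ⟨h5, h6⟩ := increment_ne_zero hl hcov hw hf
    have p1 := sub_pos.2 hlt1
    have p2 := sub_pos.2 hlt2
    have hL : j = a → IsSpline.increment lam q f (j - 1) = 0 := by
      rintro rfl
      rw [IsSpline.increment, sub_add_cancel, hf.iteratedDeriv_left le_rfl _ le_rfl,
        hf.iteratedDeriv_left le_rfl _ hlt1.le, sub_zero]
    have hR : j = b → IsSpline.increment lam q f j = 0 := by
      rintro rfl
      rw [IsSpline.increment, hf.iteratedDeriv_right le_rfl _ le_rfl,
        hf.iteratedDeriv_right le_rfl _ hlt2.le, sub_zero]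
    have hc0 : c' ≠ 0 := by
      rcases hjb.lt_or_eq with h | rfl
      · intro h0
        exact h5 j hj h (by rw [hinc', h0, zero_mul])
      · intro h0
        exact h5 (j - 1) (by omega) (by omega) (by rw [hinc, h0, zero_mul])
    rcases hj.eq_or_lt with rfl | hj'
    · exact mul_ne_zero hc0 p1.ne' (hinc ▸ hL rfl)
    rcases hjb.eq_or_lt with rfl | hjb'
    · exact mul_ne_zero hc0 p2.ne' (hinc' ▸ hR rfl)
    have h7 := h6 (j - 1) (by omega) (by omega)
    rw [sub_add_cancel, hinc, hinc'] at h7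
    nlinarith [mul_pos p1 p2, sq_nonneg c', mul_nonneg (mul_pos p1 p2).le (sq_nonneg c')]

/-- The nodes in a window can be read off from the spline, and from its derivatives. -/
theorem nodes_eq (hl : StrictMono lam) (hcov : ∀ x, ∃ j, lam j ≤ x ∧ x < lam (j + 1))
    (hw : IsWindow Z q a b) (hf : IsWindowSpline lam Z q a b f) {a' b' : ℤ} {f' : ℝ → ℝ}
    (hw' : IsWindow Z q a' b') (hf' : IsWindowSpline lam Z q a' b' f') {i : ℕ} (hi : i ≤ q)
    {r r' : ℝ} (hr : r ≠ 0) (hr' : r' ≠ 0)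
    (h : ∀ x, r * iteratedDeriv i f (x + lam a) = r' * iteratedDeriv i f' (x + lam a')) :
    b - a = b' - a' ∧ ∀ k, 0 ≤ k → k ≤ b - a → lam (a + k) - lam a = lam (a' + k) - lam a' := by
  have hset : ∀ x, x + lam a ∈ lam '' Icc a b ↔ x + lam a' ∈ lam '' Icc a' b' := by
    intro x
    rw [← nonpolynomialSet_iteratedDeriv hl hcov hw hf hi,
      ← nonpolynomialSet_iteratedDeriv hl hcov hw' hf' hi,
      ← mem_nonpolynomialSet_mul_comp_add hr, ← mem_nonpolynomialSet_mul_comp_add hr', funext h]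
  have him : ∀ a b : ℤ, a ≤ b → (fun k : ℕ => lam (a + k) - lam a) '' Iic (b - a).toNat =
      {x | x + lam a ∈ lam '' Icc a b} := by
    intro a b hab
    ext x
    constructor
    · rintro ⟨k, hk, rfl⟩
      rw [mem_Iic] at hk
      exact ⟨a + k, ⟨by omega, by omega⟩, by ring⟩
    · rintro ⟨j, hj, hj'⟩
      rw [mem_Icc] at hj
      refine ⟨(j - a).toNat, ?_, ?_⟩
      · rw [mem_Iic]; omega
      · beta_reduce
        rw [show a + ((j - a).toNat : ℤ) = j by omega]
        linarith
  have h1 := hw.add_one_lt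
  have h2 := hw'.add_one_lt
  have hmono : ∀ a : ℤ, StrictMono (fun k : ℕ => lam (a + k) - lam a) := fun a k l hkl =>
    sub_lt_sub_right (hl (by omega)) _
  obtain ⟨h3, h4⟩ := image_Iic_inj (hmono a) (hmono a') (N := (b - a).toNat)
    (N' := (b' - a').toNat) (by
      rw [him a b (by omega), him a' b' (by omega)]
      ext x
      exact hset x)
  refine ⟨by omega, fun k hk hkb => ?_⟩
  have := h4 k.toNat (by omega)
  simpa [hk] using this

/-- A negative value, besides the rise to 1 and the return to 0, would make a third increment, so
that `3 + q ≤ b - a = q + 2`. -/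
theorem integral_pos (hl : StrictMono lam) (hcov : ∀ x, ∃ j, lam j ≤ x ∧ x < lam (j + 1))
    (hab : b = a + q + 2) (hf : IsWindowSpline lam Z q a b f) : 0 < ∫ x, f x := by
  have hnn : ∀ x, 0 ≤ f x := by
    by_contra! hneg
    obtain ⟨p, hp⟩ := hneg
    have h1 : lam a < p := by
      by_contra! h
      rw [hf.left p h] at hp
      exact lt_irrefl _ hp
    have h2 : p < lam b := by
      by_contra! h
      rw [hf.right p h] at hp
      exact lt_irrefl _ hp
    have h3 : lam a < lam (a + 1) := hl (by omega)
    have h4 : lam (a + 1) < lam b := hl (by omega)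
    have hA := hf.left _ le_rfl
    have hB := hf.right _ le_rfl
    have hO := hf.one
    have ho : ∃ δ, Oscillates f 3 (lam b) δ := by
      rcases lt_trichotomy p (lam (a + 1)) with h | rfl | h
      · exact ⟨_, (((Oscillates.base (δ := -1) h1 (by linarith)).step h (by linarith)).step h4
          (by linarith))⟩
      · linarith
      · exact ⟨_, (((Oscillates.base (δ := 1) h3 (by linarith)).step h (by linarith)).step h2
          (by linarith))⟩
    obtain ⟨δ, ho⟩ := ho
    have := (hf.isSpline.increment_alternates_of_oscillates hl hcov hf.left
      (fun i hi => hf.iteratedDeriv_right hi _ le_rfl) ho le_rfl).1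
    push_cast at this
    omega
  refine hf.isSpline.contDiff.continuous.integral_pos_of_hasCompactSupport_nonneg_nonzero
    (x := lam (a + 1)) ?_ hnn (by rw [hf.one]; exact one_ne_zero)
  refine HasCompactSupport.intro (isCompact_Icc (a := lam a) (b := lam b)) fun x hx => ?_
  rw [mem_Icc, not_and_or, not_le, not_le] at hx
  rcases hx with h | h
  · exact hf.left x h.le
  · exact hf.right x h.le

end IsWindowSpline

/-! ### Counting Sturmian patterns -/

theorem ncard_range_congr {ι α β : Type*} [Inhabited ι] {f : ι → α} {g : ι → β}
    (h : ∀ x y, f x = f y ↔ g x = g y) : (range f).ncard = (range g).ncard := by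
  have hfac : Function.FactorsThrough g f := fun x y hxy => (h x y).1 hxy
  have hφ : ∀ x, Function.extend f g (fun _ => g default) (f x) = g x :=
    fun x => hfac.extend_apply _ x
  have himg : range g = Function.extend f g (fun _ => g default) '' range f := by
    rw [← range_comp]
    exact congrArg range (funext fun x => (hφ x).symm)
  refine Eq.symm (himg ▸ Set.InjOn.ncard_image ?_)
  rintro _ ⟨x, rfl⟩ _ ⟨y, rfl⟩ hxy
  rw [hφ, hφ] at hxy
  exact (h x y).2 hxy

/-- The increments of the sequence `⌊n α⌋` over a window of length `K`. -/
noncomputable def floorIncrements (α : ℝ) (K : ℕ) (n : ℤ) (i : Fin (K + 1)) : ℤ :=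
  ⌊((n + (i : ℕ) : ℤ) : ℝ) * α⌋ - ⌊(n : ℝ) * α⌋

theorem floorIncrements_eq_iff {α : ℝ} {K : ℕ} {n n' : ℤ} :
    floorIncrements α K n = floorIncrements α K n' ↔ ∀ k : ℤ, 0 ≤ k → k ≤ K →
      ⌊((n + k : ℤ) : ℝ) * α⌋ - ⌊(n : ℝ) * α⌋ = ⌊((n' + k : ℤ) : ℝ) * α⌋ - ⌊(n' : ℝ) * α⌋ := by
  constructor
  · intro h k hk hkK
    have := congrFun h ⟨k.toNat, by omega⟩
    simpa [floorIncrements, hk] using this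
  · intro h
    ext i
    exact h (i : ℕ) (by omega) (by omega)

/-- The increment is `⌊i α⌋` plus a carry, and `S n` collects the `i` that carry. These sets grow
with the fractional part of `n α`, so they are told apart by their size, which is at most `K`
because 0 never carries. The starts `0, -1, ..., -K` have distinct fractional parts and yield `K +
1` distinct sizes. -/
theorem ncard_range_floorIncrements {α : ℝ} (hα : Irrational α) (K : ℕ) :
    (range (floorIncrements α K)).ncard = K + 1 := by
  let S : ℤ → Finset ℕ := fun n => (Finset.range (K + 1)).filter
    fun i => 1 ≤ Int.fract ((n : ℝ) * α) + Int.fract ((i : ℝ) * α)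
  have hS : ∀ n i, i ∈ S n ↔ i < K + 1 ∧ 1 ≤ Int.fract ((n : ℝ) * α) + Int.fract ((i : ℝ) * α) := by
    intro n i
    simp [S]
  have hD : ∀ (n : ℤ) (i : Fin (K + 1)), floorIncrements α K n i =
      ⌊((i : ℕ) : ℝ) * α⌋ + if (i : ℕ) ∈ S n then 1 else 0 := by
    intro n i
    have h1 : ((n + (i : ℕ) : ℤ) : ℝ) * α = n * α + ((i : ℕ) : ℝ) * α := by push_cast; ring
    rw [floorIncrements, h1]
    have h2 := Int.floor_add_fract ((n : ℝ) * α)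
    have h3 := Int.floor_add_fract (((i : ℕ) : ℝ) * α)
    have h4 := Int.fract_lt_one ((n : ℝ) * α)
    have h5 := Int.fract_lt_one (((i : ℕ) : ℝ) * α)
    have h6 := Int.fract_nonneg ((n : ℝ) * α)
    have h7 := Int.fract_nonneg (((i : ℕ) : ℝ) * α)
    rw [sub_eq_iff_eq_add, Int.floor_eq_iff]
    split_ifs with h
    · rw [hS] at h
      push_cast
      constructor <;> linarith [h.2]
    · have h8 : Int.fract ((n : ℝ) * α) + Int.fract (((i : ℕ) : ℝ) * α) < 1 := by
        by_contra! h9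
        exact h ((hS _ _).2 ⟨i.2, h9⟩)
      push_cast
      constructor <;> linarith
  have hDS : ∀ n n', floorIncrements α K n = floorIncrements α K n' ↔ S n = S n' := by
    intro n n'
    constructor
    · intro h
      ext i
      by_cases hi : i < K + 1
      · have := congrFun h ⟨i, hi⟩
        rw [hD, hD] at this
        by_cases h1 : i ∈ S n <;> by_cases h2 : i ∈ S n' <;> simp [h1, h2] at this ⊢
      · simp [hS, hi]
    · intro h
      ext i
      rw [hD, hD, h]
  have hmono : ∀ n n' : ℤ, Int.fract ((n : ℝ) * α) ≤ Int.fract ((n' : ℝ) * α) → S n ⊆ S n' := by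
    intro n n' h i hi
    rw [hS] at hi ⊢
    exact ⟨hi.1, by linarith [hi.2]⟩
  have hcard : ∀ n n', S n = S n' ↔ (S n).card = (S n').card := by
    intro n n'
    refine ⟨fun h => by rw [h], fun h => ?_⟩
    rcases le_total (Int.fract ((n : ℝ) * α)) (Int.fract ((n' : ℝ) * α)) with h' | h'
    · exact Finset.eq_of_subset_of_card_le (hmono _ _ h') h.ge
    · exact (Finset.eq_of_subset_of_card_le (hmono _ _ h') h.le).symm
  rw [ncard_range_congr (g := fun n => (S n).card) fun n n' => (hDS n n').trans (hcard n n')]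
  have hle : ∀ n, (S n).card < K + 1 := by
    intro n
    have h1 : S n ⊆ (Finset.range (K + 1)).erase 0 := by
      intro i hi
      rw [hS] at hi
      refine Finset.mem_erase.2 ⟨?_, Finset.mem_range.2 hi.1⟩
      rintro rfl
      have := hi.2
      simp only [Nat.cast_zero, zero_mul, Int.fract_zero, add_zero] at this
      linarith [Int.fract_lt_one ((n : ℝ) * α)]
    have h2 := Finset.card_le_card h1
    rw [Finset.card_erase_of_mem (by simp), Finset.card_range] at h2
    omega
  have hlt : ∀ i j : ℕ, i < K + 1 → j < K + 1 →
      Int.fract (((-i : ℤ) : ℝ) * α) < Int.fract (((-j : ℤ) : ℝ) * α) →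
      (S (-i)).card < (S (-j)).card := by
    intro i j hi hj h
    -- From `-j` the index `j` just carries, the two fractional parts adding up to 1; from `-i`,
    -- with a smaller fractional part, it does not.
    refine Finset.card_lt_card ((Finset.ssubset_iff_of_subset (hmono _ _ h.le)).2 ⟨j, ?_, ?_⟩)
    all_goals
      have h1 : ((-j : ℤ) : ℝ) * α = -((j : ℝ) * α) := by push_cast; ring
      have h2 : Int.fract ((j : ℝ) * α) ≠ 0 := by
        intro h0
        have h3 := Int.fract_nonneg (((-i : ℤ) : ℝ) * α)
        rw [h1, Int.fract_neg_eq_zero.2 h0] at h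
        linarith
      rw [h1, Int.fract_neg h2] at h
    · rw [hS, h1, Int.fract_neg h2]
      exact ⟨hj, by linarith⟩
    · rw [hS, not_and, not_le]
      intro _
      linarith
  have hinj : InjOn (fun i : ℕ => (S (-i)).card) (Finset.range (K + 1) : Finset ℕ) := by
    intro i hi j hj hij
    rw [Finset.coe_range, mem_Iio] at hi hj
    rcases lt_trichotomy (Int.fract (((-i : ℤ) : ℝ) * α)) (Int.fract (((-j : ℤ) : ℝ) * α))
      with h | h | h
    · exact absurd hij (hlt i j hi hj h).ne
    · by_contra hne
      obtain ⟨z, hz⟩ := Int.fract_eq_fract.1 h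
      have h1 : (((j : ℤ) - i : ℤ) : ℝ) * α = z := by
        rw [← hz]; push_cast; ring
      have h2 := hα.intCast_mul (m := (j : ℤ) - i) (by omega)
      exact h2 ⟨z, by rw [h1]; simp⟩
    · exact absurd hij (hlt j i hj hi h).ne'
  have himg : (Finset.range (K + 1)).image (fun i : ℕ => (S (-i)).card) = Finset.range (K + 1) := by
    refine Finset.eq_of_subset_of_card_le (fun r hr => ?_) ?_
    · obtain ⟨i, -, rfl⟩ := Finset.mem_image.1 hr
      exact Finset.mem_range.2 (hle _)
    · rw [Finset.card_image_of_injOn hinj]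
  have hrange : range (fun n => (S n).card) = ((Finset.range (K + 1) : Finset ℕ) : Set ℕ) := by
    apply Subset.antisymm
    · rintro _ ⟨n, rfl⟩
      exact Finset.mem_coe.2 (Finset.mem_range.2 (hle n))
    · rw [← himg]
      intro r hr
      obtain ⟨i, -, rfl⟩ := Finset.mem_image.1 (Finset.mem_coe.1 hr)
      exact ⟨_, rfl⟩
  rw [hrange, Set.ncard_coe_finset, Finset.card_range]

/-! ### The Fibonacci chain -/

theorem eq_of_strictMono_of_range_eq {f g : ℤ → ℝ} (hf : StrictMono f) (hg : StrictMono g)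
    (h : range f = range g) (h0 : f 0 = g 0) : f = g := by
  have up : ∀ {f g : ℤ → ℝ}, StrictMono f → StrictMono g → range f = range g →
      ∀ n, f n = g n → f (n + 1) ≤ g (n + 1) := by
    intro f g hf hg h n hn
    obtain ⟨m, hm⟩ : g (n + 1) ∈ range f := h ▸ mem_range_self _
    rw [← hm]
    have : n < m := by
      rw [← hf.lt_iff_lt, hm, hn]
      exact hg (by omega)
    exact hf.monotone (by omega)
  have down : ∀ {f g : ℤ → ℝ}, StrictMono f → StrictMono g → range f = range g →
      ∀ n, f n = g n → g (n - 1) ≤ f (n - 1) := by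
    intro f g hf hg h n hn
    obtain ⟨m, hm⟩ : g (n - 1) ∈ range f := h ▸ mem_range_self _
    rw [← hm]
    have : m < n := by
      rw [← hf.lt_iff_lt, hm, hn]
      exact hg (by omega)
    exact hf.monotone (by omega)
  funext n
  induction n using Int.induction_on with
  | zero => exact h0
  | succ n ih => exact le_antisymm (up hf hg h _ ih) (up hg hf h.symm _ ih.symm)
  | pred n ih => exact le_antisymm (down hg hf h.symm _ ih.symm) (down hf hg h _ ih)

local notation "τ" => Real.goldenRatio

theorem inv_goldenRatio_eq : τ⁻¹ = τ - 1 := by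
  have h1 := Real.goldenRatio_sq
  exact inv_eq_of_mul_eq_one_right (by linear_combination h1)

theorem inv_goldenRatio_pos : 0 < τ⁻¹ := inv_pos.2 Real.goldenRatio_pos

theorem inv_goldenRatio_sq : τ⁻¹ * τ⁻¹ = 1 - τ⁻¹ := by
  rw [inv_goldenRatio_eq]
  have h1 := Real.goldenRatio_sq
  nlinarith

theorem inv_goldenRatio_lt_one : τ⁻¹ < 1 := inv_lt_one_of_one_lt₀ Real.one_lt_goldenRatio

theorem irrational_inv_goldenRatio : Irrational τ⁻¹ := Real.goldenRatio_irrational.inv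

/-- For given `b`, the condition on `a - b / τ` forces `a = ⌈b / τ⌉`; thus `b` enumerates the chain.
-/
theorem chain_eq {lam : ℤ → ℝ} (hl : StrictMono lam) (hr : range lam = rescaledChain)
    (h0 : lam 0 = 0) (k : ℤ) :
    lam k = ((⌈(k : ℝ) * τ⁻¹⌉ : ℤ) + k * τ) / τ ^ 2 := by
  have hτ : 0 < τ := Real.goldenRatio_pos
  have hm : StrictMono fun k : ℤ => ((⌈(k : ℝ) * τ⁻¹⌉ : ℤ) + (k : ℝ) * τ) / τ ^ 2 := by
    intro j k hjk
    have hjk' : (j : ℝ) < k := by exact_mod_cast hjk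
    have h1 : ((⌈(j : ℝ) * τ⁻¹⌉ : ℤ) : ℝ) ≤ (⌈(k : ℝ) * τ⁻¹⌉ : ℤ) := by
      exact_mod_cast Int.ceil_mono (mul_le_mul_of_nonneg_right hjk'.le inv_goldenRatio_pos.le)
    have h2 : (j : ℝ) * τ < k * τ := by gcongr
    exact div_lt_div_of_pos_right (add_lt_add_of_le_of_lt h1 h2) (by positivity)
  refine congrFun (eq_of_strictMono_of_range_eq hl hm ?_ (by simp [h0])) k
  rw [hr]
  ext x
  constructor
  · rintro ⟨_, ⟨a, b, rfl, h0, h1⟩, rfl⟩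
    rw [div_eq_mul_inv] at h0 h1
    have ha : ⌈(b : ℝ) * τ⁻¹⌉ = a := by
      rw [Int.ceil_eq_iff]
      constructor <;> linarith
    exact ⟨b, by beta_reduce; rw [ha]⟩
  · rintro ⟨k, rfl⟩
    refine ⟨_, ⟨⌈(k : ℝ) * τ⁻¹⌉, k, rfl, ?_, ?_⟩, rfl⟩
    · rw [div_eq_mul_inv]; linarith [Int.le_ceil ((k : ℝ) * τ⁻¹)]
    · rw [div_eq_mul_inv]; linarith [Int.ceil_lt_add_one ((k : ℝ) * τ⁻¹)]

/-- The index of the `k`-th long tile. -/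
noncomputable def longIndex (k : ℤ) : ℤ := ⌊(k : ℝ) * τ⌋

theorem longIndex_strictMono : StrictMono longIndex := by
  refine strictMono_int_of_lt_succ fun k => ?_
  rw [longIndex, longIndex, Int.lt_iff_add_one_le, Int.le_floor]
  push_cast
  linarith [Int.floor_le ((k : ℝ) * τ), Real.one_lt_goldenRatio]

theorem longIndex_succ_le (k : ℤ) : longIndex (k + 1) ≤ longIndex k + 2 := by
  have h : longIndex (k + 1) < longIndex k + 3 := by
    rw [longIndex, longIndex, Int.floor_lt]
    push_cast
    linarith [Int.lt_floor_add_one ((k : ℝ) * τ), Real.goldenRatio_lt_two]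
  omega

theorem longIndex_succ_of_mem {k : ℤ} (h : longIndex k + 1 ∈ range longIndex) :
    longIndex (k + 1) = longIndex k + 1 := by
  obtain ⟨l, hl⟩ := h
  have h1 : k < l := longIndex_strictMono.lt_iff_lt.1 (by omega)
  have h2 := longIndex_strictMono.monotone (show k + 1 ≤ l by omega)
  have h3 := longIndex_strictMono (show k < k + 1 by omega)
  omega

theorem longIndex_succ_of_notMem {k : ℤ} (h : longIndex k + 1 ∉ range longIndex) :
    longIndex (k + 1) = longIndex k + 2 := by
  have h1 := longIndex_succ_le k
  have h2 := longIndex_strictMono (show k < k + 1 by omega)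
  have h3 : longIndex (k + 1) ≠ longIndex k + 1 := fun e => h ⟨_, e⟩
  omega

/-- `⌊k τ⌋ = j` means that the integer `k` lies in `[j / τ, (j + 1) / τ)`. -/
theorem mem_range_longIndex {j : ℤ} :
    j ∈ range longIndex ↔ ⌈(j : ℝ) * τ⁻¹⌉ < ⌈((j + 1 : ℤ) : ℝ) * τ⁻¹⌉ := by
  have hτ : 0 < τ := Real.goldenRatio_pos
  have key : ∀ k : ℤ, longIndex k = j ↔ (j : ℝ) * τ⁻¹ ≤ k ∧ (k : ℝ) < ((j + 1 : ℤ) : ℝ) * τ⁻¹ := by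
    intro k
    rw [longIndex, Int.floor_eq_iff, ← div_eq_mul_inv, ← div_eq_mul_inv, div_le_iff₀ hτ,
      lt_div_iff₀ hτ]
    push_cast
    rfl
  rw [Int.lt_ceil]
  constructor
  · rintro ⟨k, hk⟩
    obtain ⟨h1, h2⟩ := (key k).1 hk
    exact lt_of_le_of_lt (by exact_mod_cast Int.ceil_le.2 h1) h2
  · intro h
    exact ⟨_, (key _).2 ⟨Int.le_ceil _, h⟩⟩

section chain

variable {lam : ℤ → ℝ}

/-- The ceiling grows by 1 or 0 across a tile, and the length is accordingly `(1 + τ) / τ² = 1` or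
`τ / τ² = τ⁻¹`. -/
theorem chain_gap (hlam : ∀ k : ℤ, lam k = ((⌈(k : ℝ) * τ⁻¹⌉ : ℤ) + k * τ) / τ ^ 2) (j : ℤ) :
    (j ∈ range longIndex → lam (j + 1) - lam j = 1) ∧
    (j ∉ range longIndex → lam (j + 1) - lam j = τ⁻¹) := by
  have hτ : 0 < τ := Real.goldenRatio_pos
  have h1 := Real.goldenRatio_sq
  have h2 : ⌈(j : ℝ) * τ⁻¹⌉ ≤ ⌈((j + 1 : ℤ) : ℝ) * τ⁻¹⌉ :=
    Int.ceil_mono (mul_le_mul_of_nonneg_right (by push_cast; linarith) inv_goldenRatio_pos.le)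
  have h3 : ⌈((j + 1 : ℤ) : ℝ) * τ⁻¹⌉ ≤ ⌈(j : ℝ) * τ⁻¹⌉ + 1 := by
    rw [Int.ceil_le]
    push_cast
    linarith [Int.le_ceil ((j : ℝ) * τ⁻¹), inv_goldenRatio_lt_one]
  rw [mem_range_longIndex, hlam, hlam]
  constructor
  · intro h
    rw [show ⌈((j + 1 : ℤ) : ℝ) * τ⁻¹⌉ = ⌈(j : ℝ) * τ⁻¹⌉ + 1 by omega]
    rw [← sub_div, div_eq_iff (by positivity)]
    push_cast
    linear_combination -h1
  · intro h
    rw [show ⌈((j + 1 : ℤ) : ℝ) * τ⁻¹⌉ = ⌈(j : ℝ) * τ⁻¹⌉ by omega]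
    push_cast
    field_simp
    ring

theorem chain_cover
    (hlam : ∀ k : ℤ, lam k = ((⌈(k : ℝ) * τ⁻¹⌉ : ℤ) + k * τ) / τ ^ 2) (x : ℝ) :
    ∃ j, lam j ≤ x ∧ x < lam (j + 1) := by
  have hτ : 0 < τ := Real.goldenRatio_pos
  have h1 : ∀ j : ℤ, j ≤ 0 → lam j ≤ j / τ := by
    intro j hj
    have h2 : ⌈(j : ℝ) * τ⁻¹⌉ ≤ 0 := by
      rw [Int.ceil_le, Int.cast_zero]
      exact mul_nonpos_of_nonpos_of_nonneg (by exact_mod_cast hj) inv_goldenRatio_pos.le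
    have h3 : ((⌈(j : ℝ) * τ⁻¹⌉ : ℤ) : ℝ) ≤ 0 := by exact_mod_cast h2
    rw [hlam, div_le_div_iff₀ (by positivity) hτ]
    nlinarith
  have h2 : ∀ j : ℤ, 0 ≤ j → j / τ ≤ lam j := by
    intro j hj
    have h2 : 0 ≤ ⌈(j : ℝ) * τ⁻¹⌉ := 
      Int.ceil_nonneg (mul_nonneg (by exact_mod_cast hj) inv_goldenRatio_pos.le)
    have h3 : (0 : ℝ) ≤ ((⌈(j : ℝ) * τ⁻¹⌉ : ℤ) : ℝ) := by exact_mod_cast h2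
    rw [hlam, div_le_div_iff₀ hτ (by positivity)]
    nlinarith
  obtain ⟨j, hj, hmax⟩ := Int.exists_greatest_of_bdd (P := fun j => lam j ≤ x)
    ⟨max 0 ⌈x * τ⌉, fun z hz => by
      rcases le_total z 0 with h | h
      · exact le_max_of_le_left h
      · refine le_max_of_le_right ?_
        have h3 := (h2 z h).trans hz
        rw [div_le_iff₀ hτ] at h3
        exact_mod_cast h3.trans (Int.le_ceil _)⟩
    ⟨min 0 ⌊x * τ⌋, by
      refine (h1 _ (min_le_left _ _)).trans ?_
      rw [div_le_iff₀ hτ]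
      refine le_trans ?_ (Int.floor_le _)
      exact_mod_cast min_le_right _ _⟩
  refine ⟨j, hj, ?_⟩
  by_contra! h
  have := hmax _ h
  omega

/-- Multiplication by `τ²` takes `c + k τ` to `(k + c) + (2 k + c) τ`, and `2 k + c = ⌈k τ²⌉`. The
point is that `k + c` is again the ceiling that belongs to the new index. -/
theorem chain_inflation (hlam : ∀ k : ℤ, lam k = ((⌈(k : ℝ) * τ⁻¹⌉ : ℤ) + k * τ) / τ ^ 2)
    (k : ℤ) : τ ^ 2 * lam k = lam ⌈(k : ℝ) * τ ^ 2⌉ := by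
  have hτ : 0 < τ := Real.goldenRatio_pos
  have h1 := Real.goldenRatio_sq
  have h2 := inv_goldenRatio_eq
  have h3 := inv_goldenRatio_sq
  have h4 := inv_goldenRatio_pos
  set c := ⌈(k : ℝ) * τ⁻¹⌉ with hc
  have h5 := Int.le_ceil ((k : ℝ) * τ⁻¹)
  have h6 := Int.ceil_lt_add_one ((k : ℝ) * τ⁻¹)
  rw [← hc] at h5 h6
  have hm : ⌈(k : ℝ) * τ ^ 2⌉ = 2 * k + c := by
    rw [show (k : ℝ) * τ ^ 2 = ((2 * k : ℤ) : ℝ) + k * τ⁻¹ by rw [h1, h2]; push_cast; ring,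
      Int.ceil_intCast_add]
  have hA : ⌈((2 * k + c : ℤ) : ℝ) * τ⁻¹⌉ = k + c := by
    -- The defect `c - k / τ` in `[0, 1)` gets multiplied by `τ⁻²`, so it stays in `[0, 1)`.
    have h7 : ((2 * k + c : ℤ) : ℝ) * τ⁻¹ = k + c - τ⁻¹ * τ⁻¹ * (c - k * τ⁻¹) := by
      push_cast
      linear_combination (c - k * τ⁻¹ + k : ℝ) * h3
    have h8 : 0 < τ⁻¹ * τ⁻¹ := mul_pos h4 h4
    rw [Int.ceil_eq_iff, h7]
    push_cast
    constructor <;> nlinarith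
  rw [hm, hlam, hlam, hA, ← hc]
  have hne : τ ^ 2 ≠ 0 := by positivity
  rw [mul_div_assoc', mul_div_cancel_left₀ _ hne, eq_div_iff hne]
  push_cast
  linear_combination (k * τ + c + k : ℝ) * h1

/-- By `chain_inflation`, `lam (n + 1)` lies in `τ² Λ` exactly when `n = ⌈k τ²⌉ - 1` for some `k`.
As `τ` and `τ²` are conjugate exponents, Beatty's theorem leaves the integers `⌊k τ⌋`. -/
theorem indexSet_eq_range (hl : StrictMono lam)
    (hlam : ∀ k : ℤ, lam k = ((⌈(k : ℝ) * τ⁻¹⌉ : ℤ) + k * τ) / τ ^ 2) :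
    indexSet lam (τ ^ 2) = range longIndex := by
  have hconj : Real.HolderConjugate τ (τ ^ 2) := by
    refine Real.holderConjugate_iff.2 ⟨Real.one_lt_goldenRatio, ?_⟩
    rw [sq, mul_inv, inv_goldenRatio_sq]
    ring
  have h1 : range longIndex = {x | ∃ k, beattySeq τ k = x} := rfl
  rw [h1, ← compl_compl {x | ∃ k, beattySeq τ k = x}, compl_beattySeq hconj]
  ext n
  refine not_congr ⟨?_, ?_⟩
  · rintro ⟨k, hk⟩
    beta_reduce at hk
    rw [chain_inflation hlam] at hk
    refine ⟨k, ?_⟩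
    rw [beattySeq', hl.injective hk, add_sub_cancel_right]
  · rintro ⟨k, hk⟩
    refine ⟨k, ?_⟩
    beta_reduce
    rw [chain_inflation hlam, ← hk, beattySeq', sub_add_cancel]

theorem chain_sub_eq_iff (hlam : ∀ k : ℤ, lam k = ((⌈(k : ℝ) * τ⁻¹⌉ : ℤ) + k * τ) / τ ^ 2)
    {n n' : ℤ} {K : ℕ} : floorIncrements (-τ⁻¹) K n = floorIncrements (-τ⁻¹) K n' ↔
    ∀ k : ℤ, 0 ≤ k → k ≤ K → lam (n + k) - lam n = lam (n' + k) - lam n' := by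
  have hτ : 0 < τ := Real.goldenRatio_pos
  have key : ∀ n k : ℤ, lam (n + k) - lam n = (k * τ -
      ((⌊((n + k : ℤ) : ℝ) * -τ⁻¹⌋ - ⌊(n : ℝ) * -τ⁻¹⌋ : ℤ) : ℝ)) / τ ^ 2 := by
    intro n k
    rw [hlam, hlam, mul_neg, mul_neg, Int.floor_neg, Int.floor_neg]
    push_cast
    ring
  rw [floorIncrements_eq_iff]
  refine forall₃_congr fun k _ _ => ?_
  rw [key, key]
  constructor
  · intro h
    rw [h]
  · intro h
    rw [div_left_inj' (by positivity), sub_right_inj] at h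
    exact_mod_cast h

theorem mem_range_longIndex_iff_of_sub_eq
    (hlam : ∀ k : ℤ, lam k = ((⌈(k : ℝ) * τ⁻¹⌉ : ℤ) + k * τ) / τ ^ 2) {n n' k : ℤ}
    (h1 : lam (n + k) - lam n = lam (n' + k) - lam n')
    (h2 : lam (n + (k + 1)) - lam n = lam (n' + (k + 1)) - lam n') :
    n + k ∈ range longIndex ↔ n' + k ∈ range longIndex := by
  have h3 := chain_gap hlam (n + k)
  have h4 := chain_gap hlam (n' + k)
  have h5 := inv_goldenRatio_lt_one
  rw [← add_assoc, ← add_assoc] at h2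
  by_cases h6 : n + k ∈ range longIndex <;> by_cases h7 : n' + k ∈ range longIndex
  · simp [h6, h7]
  · linarith [h3.1 h6, h4.2 h7]
  · linarith [h3.2 h6, h4.1 h7]
  · simp [h6, h7]

/-- The windows attached to the long tiles `k` and `k'` carry the same nodes, up to a translation,
if and only if the next `q + 1` long tiles have the same relative indices. -/
theorem floorIncrements_goldenRatio_eq_iff
    (hlam : ∀ k : ℤ, lam k = ((⌈(k : ℝ) * τ⁻¹⌉ : ℤ) + k * τ) / τ ^ 2) {q : ℕ} {k k' : ℤ} :
    floorIncrements τ (q + 1) k = floorIncrements τ (q + 1) k' ↔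
    (longIndex (k + q) + 2 - longIndex k = longIndex (k' + q) + 2 - longIndex k' ∧
    ∀ i, 0 ≤ i → i ≤ longIndex (k + q) + 2 - longIndex k →
      lam (longIndex k + i) - lam (longIndex k) = lam (longIndex k' + i) - lam (longIndex k')) := by
  rw [floorIncrements_eq_iff]
  change (∀ t : ℤ, 0 ≤ t → t ≤ (q + 1 : ℕ) → longIndex (k + t) - longIndex k =
    longIndex (k' + t) - longIndex k') ↔ _
  constructor
  · have half : ∀ {k k' : ℤ}, (∀ t : ℤ, 0 ≤ t → t ≤ (q + 1 : ℕ) → longIndex (k + t) - longIndex k =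
        longIndex (k' + t) - longIndex k') → ∀ i, 0 ≤ i → i < longIndex (k + q) + 2 - longIndex k →
        longIndex k + i ∈ range longIndex → longIndex k' + i ∈ range longIndex := by
      rintro k k' h i hi hib ⟨l, hl⟩
      have h1 : k ≤ l := longIndex_strictMono.le_iff_le.1 (by omega)
      have h2 : l ≤ k + q + 1 := by
        refine longIndex_strictMono.le_iff_le.1 ?_
        have := longIndex_strictMono (show k + q < k + q + 1 by omega)
        omega
      refine ⟨k' + (l - k), ?_⟩
      have h3 := h (l - k) (by omega) (by push_cast; omega)
      rw [add_sub_cancel] at h3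
      omega
    intro h
    have hq := h q (by omega) (by push_cast; omega)
    refine ⟨by omega, fun i hi => ?_⟩
    induction i, hi using Int.leInduction with
    | base => simp
    | succ i hi ih =>
      intro hib
      have h1 := ih (by omega)
      have h2 := chain_gap hlam (longIndex k + i)
      have h3 := chain_gap hlam (longIndex k' + i)
      rw [← add_assoc, ← add_assoc]
      have h4 : longIndex k + i ∈ range longIndex ↔ longIndex k' + i ∈ range longIndex :=
        ⟨half h i hi (by omega), half (fun t ht ht' => (h t ht ht').symm) i hi (by omega)⟩
      by_cases h5 : longIndex k + i ∈ range longIndex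
      · linarith [h2.1 h5, h3.1 (h4.1 h5)]
      · linarith [h2.2 h5, h3.2 (fun h6 => h5 (h4.2 h6))]
  · rintro ⟨-, h⟩ t ht
    induction t, ht using Int.leInduction with
    | base => simp
    | succ t ht ih =>
      intro htq
      push_cast at htq
      have h1 := ih (by push_cast; omega)
      have h2 := longIndex_strictMono.monotone (show k + t ≤ k + q by omega)
      have h3 := longIndex_strictMono.monotone (show k ≤ k + t by omega)
      -- The tile right after a long one decides whether the next long tile is one or two steps
      -- away. Even for `t = q` that tile is within the window, which ends at `longIndex (k + q) +
      -- 2`.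
      have h4 := mem_range_longIndex_iff_of_sub_eq hlam
        (h (longIndex (k + t) + 1 - longIndex k) (by omega) (by omega))
        (h (longIndex (k + t) + 1 - longIndex k + 1) (by omega) (by omega))
      rw [show longIndex k + (longIndex (k + t) + 1 - longIndex k) = longIndex (k + t) + 1 by ring,
        show longIndex k' + (longIndex (k + t) + 1 - longIndex k) = longIndex (k' + t) + 1 by omega]
        at h4
      rw [← add_assoc, ← add_assoc]
      by_cases h5 : longIndex (k + t) + 1 ∈ range longIndex
      · rw [longIndex_succ_of_mem h5, longIndex_succ_of_mem (h4.1 h5)]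
        omega
      · rw [longIndex_succ_of_notMem h5, longIndex_succ_of_notMem (fun h6 => h5 (h4.2 h6))]
        omega

end chain

/-! ### The windows of the two problems and their lengths -/

theorem isWindow_longIndex (q : ℕ) (k : ℤ) :
    IsWindow {j | j - 1 ∉ range longIndex} q (longIndex k) (longIndex (k + q) + 2) := by
  refine ⟨?_, ?_, ?_⟩
  · simp
  · simp [show longIndex (k + q) + 2 - 1 - 1 = longIndex (k + q) by ring]
  · have : Ioo (longIndex k) (longIndex (k + q) + 2) \ {j | j - 1 ∉ range longIndex} =
        (fun l => longIndex l + 1) '' (Finset.Icc k (k + q) : Finset ℤ) := by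
      ext j
      simp only [mem_sdiff, mem_Ioo, mem_ofPred_eq, not_not, Finset.coe_Icc, mem_image, mem_Icc]
      constructor
      · rintro ⟨⟨h1, h2⟩, l, hl⟩
        have h3 : k ≤ l := longIndex_strictMono.le_iff_le.1 (by omega)
        have h4 : l ≤ k + q := longIndex_strictMono.le_iff_le.1 (by omega)
        exact ⟨l, ⟨h3, h4⟩, by omega⟩
      · rintro ⟨l, ⟨h3, h4⟩, rfl⟩
        have h5 := longIndex_strictMono.monotone h3
        have h6 := longIndex_strictMono.monotone h4
        exact ⟨⟨by omega, by omega⟩, l, by omega⟩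
    rw [this, Set.ncard_image_of_injective, Set.ncard_coe_finset, Int.card_Icc]
    · omega
    · intro x y hxy
      exact longIndex_strictMono.injective (by simpa using hxy)

theorem isWindow_empty (q : ℕ) (n : ℤ) : IsWindow ∅ q n (n + q + 2) := by
  refine ⟨by simp, by simp, ?_⟩
  rw [sdiff_empty, ← Finset.coe_Ioo, Set.ncard_coe_finset, Int.card_Ioo]
  omega

/-- `⌊(k + q) τ⌋ - ⌊k τ⌋` differs from `q τ` by less than 1. -/
theorem longIndex_window_length (q : ℕ) (k : ℤ) :
    longIndex (k + q) + 2 - longIndex k = ⌈(q : ℝ) * τ⌉ + 1 ∨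
    longIndex (k + q) + 2 - longIndex k = ⌈(q : ℝ) * τ⌉ + 1 + 1 := by
  have h1 : longIndex k + ⌈(q : ℝ) * τ⌉ - 1 ≤ longIndex (k + q) := by
    rw [longIndex, longIndex, Int.le_floor]
    push_cast
    linarith [Int.floor_le ((k : ℝ) * τ), Int.ceil_lt_add_one ((q : ℝ) * τ)]
  have h2 : longIndex (k + q) < longIndex k + ⌈(q : ℝ) * τ⌉ + 1 := by
    rw [longIndex, longIndex, Int.floor_lt]
    push_cast
    linarith [Int.lt_floor_add_one ((k : ℝ) * τ), Int.le_ceil ((q : ℝ) * τ)]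
  omega

theorem longIndex_window_length_zero {q : ℕ} (hq : 0 < q) :
    longIndex (0 + q) + 2 - longIndex 0 = ⌈(q : ℝ) * τ⌉ + 1 := by
  have h1 : ⌈(q : ℝ) * τ⌉ = ⌊(q : ℝ) * τ⌋ + 1 := by
    refine Int.ceil_eq_floor_add_one_iff_notMem _ |>.2 ?_
    rintro ⟨z, hz⟩
    exact (Real.goldenRatio_irrational.natCast_mul hq.ne') ⟨z, by rw [← hz]; simp⟩
  simp [longIndex, h1]
  ring

theorem longIndex_window_length_neg (q : ℕ) :
    longIndex (-q + q) + 2 - longIndex (-q) = ⌈(q : ℝ) * τ⌉ + 1 + 1 := by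
  simp [longIndex, Int.floor_neg]
  ring

/-! ### From real to `𝕜`-valued splines -/

theorem isSpline_clm_comp {𝕜 : Type*} [RCLike 𝕜] {lam : ℤ → ℝ} {q : ℕ} {f : ℝ → 𝕜}
    (hf : f ∈ splineSpace 𝕜 lam (q + 2)) (L : 𝕜 →L[ℝ] ℝ) : IsSpline lam q (fun x => L (f x)) := by
  obtain ⟨h1, -, h3⟩ := hf
  refine ⟨L.contDiff.comp h1, fun n => ?_⟩
  obtain ⟨P, hP, hPf⟩ := h3 n
  have hdeg : P.natDegree < q + 2 := by
    rcases eq_or_ne P 0 with rfl | h0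
    · simp
    · rw [Polynomial.degree_eq_natDegree h0] at hP
      exact_mod_cast hP
  refine ⟨∑ i ∈ Finset.range (q + 2), Polynomial.monomial i (L (P.coeff i)), ?_, fun x hx => ?_⟩
  · rw [← Polynomial.mem_degreeLT]
    refine Submodule.sum_mem _ fun i hi => Polynomial.mem_degreeLT.2 ?_
    exact (Polynomial.degree_monomial_le _ _).trans_lt
      (by exact_mod_cast Finset.mem_range.1 hi)
  · rw [hPf x hx, Polynomial.eval_eq_sum_range' hdeg, map_sum, Polynomial.eval_finsetSum]
    refine Finset.sum_congr rfl fun i _ => ?_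
    rw [Polynomial.eval_monomial, mul_comm (P.coeff i), ← RCLike.ofReal_pow,
      ← RCLike.real_smul_eq_coe_mul, map_smul, smul_eq_mul, mul_comm]

namespace IsSpline

variable {lam : ℤ → ℝ} {q : ℕ} {f : ℝ → ℝ}

theorem ofReal_mem_splineSpace (𝕜 : Type*) [RCLike 𝕜] (hf : IsSpline lam q f)
    (hc : HasCompactSupport f) : (fun x => (f x : 𝕜)) ∈ splineSpace 𝕜 lam (q + 2) := by
  have hcont : ContDiff ℝ q (fun x => (f x : 𝕜)) :=
    (RCLike.ofRealCLM (K := 𝕜)).contDiff.comp hf.contDiff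
  refine ⟨hcont, ?_, fun n => ?_⟩
  · refine hcont.continuous.memLp_of_hasCompactSupport ?_
    exact hc.comp_left (g := fun x : ℝ => (x : 𝕜)) RCLike.ofReal_zero
  · obtain ⟨P, hP, hPf⟩ := hf.piece n
    refine ⟨P.map (algebraMap ℝ 𝕜), (Polynomial.degree_map_le).trans_lt hP, fun x hx => ?_⟩
    beta_reduce
    rw [hPf x hx, ← RCLike.algebraMap_eq_ofReal, Polynomial.eval_map, Polynomial.eval₂_at_apply]

theorem tile_subset_tsupport (hl : StrictMono lam) (hf : IsSpline lam q f) {j : ℤ}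
    (h : ∃ x ∈ Icc (lam j) (lam (j + 1)), f x ≠ 0) : Icc (lam j) (lam (j + 1)) ⊆ tsupport f := by
  have hlt : lam j < lam (j + 1) := hl (by omega)
  obtain ⟨y, hy, hy0⟩ := h
  obtain ⟨P, -, hP⟩ := hf.piece j
  rw [← closure_Ioo hlt.ne]
  refine closure_minimal (fun x hx => ?_) (isClosed_tsupport _)
  by_contra hno
  rw [notMem_tsupport_iff_eventuallyEq] at hno
  have h1 : {x | P.IsRoot x} ∈ nhds x := by
    filter_upwards [hno, isOpen_Ioo.mem_nhds hx] with z hz hz'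
    change P.eval z = 0
    rw [← hP z (Ioo_subset_Icc_self hz'), hz]
    rfl
  have h2 := Polynomial.eq_zero_of_infinite_isRoot P (infinite_of_mem_nhds x h1)
  rw [hP y hy, h2, Polynomial.eval_zero] at hy0
  exact hy0 rfl

end IsSpline

theorem support_subset_Ioo {𝕜 : Type*} [RCLike 𝕜] {g : ℝ → 𝕜} (hg : Continuous g) {a b : ℝ}
    (h : tsupport g ⊆ Icc a b) : Function.support g ⊆ Ioo a b := by
  rw [← interior_Icc]
  exact interior_maximal ((subset_tsupport g).trans h) hg.isOpen_support

theorem iteratedDeriv_ofReal (𝕜 : Type*) [RCLike 𝕜] {n : ℕ} {f : ℝ → ℝ} (hf : ContDiff ℝ n f) :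
    iteratedDeriv n (fun x => (f x : 𝕜)) = fun x => ((iteratedDeriv n f x : ℝ) : 𝕜) := by
  induction n generalizing f with
  | zero => simp
  | succ n ih =>
    push_cast at hf
    obtain ⟨h1, -, h2⟩ := contDiff_succ_iff_deriv.1 hf
    rw [iteratedDeriv_succ', iteratedDeriv_succ', ← ih h2]
    congr 1
    ext x
    exact ((RCLike.ofRealCLM (K := 𝕜)).hasFDerivAt.comp_hasDerivAt x (h1 x).hasDerivAt).deriv

theorem tsupport_ofReal (𝕜 : Type*) [RCLike 𝕜] (f : ℝ → ℝ) :
    tsupport (fun x => (f x : 𝕜)) = tsupport f := by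
  have : Function.support (fun x => (f x : 𝕜)) = Function.support f := by
    ext x
    simp
  rw [tsupport, tsupport, this]

theorem toReal_eLpNorm_ne_zero {𝕜 : Type*} [RCLike 𝕜] {h : ℝ → 𝕜} (hc : Continuous h)
    (hs : HasCompactSupport h) {x : ℝ} (hx : h x ≠ 0) : (eLpNorm h 2 volume).toReal ≠ 0 := by
  have h1 : MemLp h 2 volume := hc.memLp_of_hasCompactSupport hs
  refine ENNReal.toReal_ne_zero.2 ⟨fun h0 => ?_, h1.2.ne⟩
  rw [eLpNorm_eq_zero_iff h1.1 (by norm_num)] at h0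
  exact hx (congrFun ((hc.ae_eq_iff_eq volume (continuous_const (y := (0 : 𝕜)))).1 h0) x)

namespace IsWindowSpline

variable {𝕜 : Type*} [RCLike 𝕜] {lam : ℤ → ℝ} {q : ℕ} {f : ℝ → ℝ} {Z : Set ℤ} {a b : ℤ}

theorem tsupport_eq (hl : StrictMono lam) (hcov : ∀ x, ∃ j, lam j ≤ x ∧ x < lam (j + 1))
    (hw : IsWindow Z q a b) (hf : IsWindowSpline lam Z q a b f) :
    tsupport f = Icc (lam a) (lam b) := by
  simpa using hf.tsupport_iteratedDeriv hl hcov hw (Nat.zero_le q)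

theorem hasCompactSupport (hl : StrictMono lam) (hcov : ∀ x, ∃ j, lam j ≤ x ∧ x < lam (j + 1))
    (hw : IsWindow Z q a b) (hf : IsWindowSpline lam Z q a b f) : HasCompactSupport f := by
  rw [HasCompactSupport, hf.tsupport_eq hl hcov hw]
  exact isCompact_Icc

theorem eq_mul_ofReal (hl : StrictMono lam) (hcov : ∀ x, ∃ j, lam j ≤ x ∧ x < lam (j + 1))
    (hw : IsWindow Z q a b) (hf : IsWindowSpline lam Z q a b f) {g : ℝ → 𝕜}
    (hg : g ∈ splineSpace 𝕜 lam (q + 2)) (hZ : ∀ j ∈ Z, g (lam j) = 0)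
    (hs : tsupport g ⊆ Icc (lam a) (lam b)) (x : ℝ) : g x = g (lam (a + 1)) * f x := by
  have hsupp := support_subset_Ioo hg.1.continuous hs
  have h0 : ∀ x, x ∉ Ioo (lam a) (lam b) → g x = 0 := by
    intro x hx
    by_contra hgx
    exact hx (hsupp hgx)
  have key : ∀ L : 𝕜 →L[ℝ] ℝ, L (g x) = L (g (lam (a + 1))) * f x := fun L =>
    hf.eq_mul hl hcov hw (isSpline_clm_comp hg L) (fun j hj => by rw [hZ j hj, map_zero])
      (fun x hx => by rw [h0 x (fun h => not_lt.2 hx h.1), map_zero])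
      (fun x hx => by rw [h0 x (fun h => not_lt.2 hx h.2), map_zero]) x
  have h1 := key RCLike.reCLM
  have h2 := key RCLike.imCLM
  refine RCLike.ext ?_ ?_
  · simpa using h1
  · simpa using h2

/-- The real part is 1 at `lam (a + 1)`, so `ne_zero_on_window` applies to it. -/
theorem Icc_subset_tsupport (hl : StrictMono lam)
    (hcov : ∀ x, ∃ j, lam j ≤ x ∧ x < lam (j + 1)) (hw : IsWindow Z q a b) {g : ℝ → 𝕜}
    (hg : g ∈ splineSpace 𝕜 lam (q + 2)) (hZ : ∀ j ∈ Z, g (lam j) = 0)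
    (hc : HasCompactSupport g) (hs : tsupport g ⊆ Ici (lam a)) (h1 : g (lam (a + 1)) = 1) :
    Icc (lam a) (lam b) ⊆ tsupport g := by
  have hr := isSpline_clm_comp hg RCLike.reCLM
  obtain ⟨R, hR⟩ := hc.isCompact.bddAbove
  obtain ⟨c, -, hc'⟩ := hcov R
  have hsupp : Function.support g ⊆ Ioo (lam a) (lam (c + 1) + 1) :=
    support_subset_Ioo hg.1.continuous fun x hx => ⟨hs hx, by linarith [hR hx]⟩
  have hleft : ∀ x ≤ lam a, RCLike.reCLM (g x) = 0 := by
    intro x hx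
    rw [Function.notMem_support.1 fun h => not_lt.2 hx (hsupp h).1, map_zero]
  have hright : ∀ x, lam (c + 1) ≤ x → RCLike.reCLM (g x) = 0 := by
    intro x hx
    rw [Function.notMem_support.1 fun h => not_lt.2 hx ((hR (subset_tsupport g h)).trans_lt hc'),
      map_zero]
  obtain ⟨b', hb, -, hne, -⟩ := hr.ne_zero_on_window hl hcov hw
    (fun j hj => by rw [hZ j hj, map_zero]) hleft hright (by rw [h1]; simp)
  have hab := hw.add_one_lt
  have hsub : tsupport (fun x => RCLike.reCLM (g x)) ⊆ tsupport g := by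
    refine closure_mono fun x hx h0 => hx ?_
    beta_reduce
    rw [h0, map_zero]
  refine Subset.trans (fun x hx => ?_) hsub
  obtain ⟨j, hj, hj'⟩ := hcov x
  have h2 : a < j + 1 := hl.lt_iff_lt.1 (hx.1.trans_lt hj')
  have h3 : j ≤ b := hl.le_iff_le.1 (hj.trans hx.2)
  rcases h3.lt_or_eq with h4 | rfl
  · exact hr.tile_subset_tsupport hl (hne j (by omega) (by omega)) ⟨hj, hj'.le⟩
  · have h5 := hr.tile_subset_tsupport hl (hne (j - 1) (by omega) (by omega))
    rw [sub_add_cancel] at h5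
    exact h5 ⟨(hl.monotone (by omega)).trans hj, hx.2⟩

/-- The support of a candidate `Ψ` contains the window, so its minimality can be tested on `f`: `f =
c Ψ`, and the values at `lam (a + 1)` give `c = 1`. Conversely, splines supported in the window are
multiples of `f`. -/
theorem isMinimalSpline_iff (hl : StrictMono lam)
    (hcov : ∀ x, ∃ j, lam j ≤ x ∧ x < lam (j + 1)) (hw : IsWindow Z q a b)
    (hf : IsWindowSpline lam Z q a b f) {θ : ℝ}
    (hθ : ∀ g : ℝ → 𝕜, (∀ k, g (θ * lam k) = 0) ↔ ∀ j ∈ Z, g (lam j) = 0) {Ψ : ℝ → 𝕜} :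
    IsMinimalSpline lam θ (q + 2) a Ψ ↔ Ψ = fun x => (f x : 𝕜) := by
  have hmem : (fun x => (f x : 𝕜)) ∈ vanishingSplines 𝕜 lam θ (q + 2) :=
    ⟨hf.isSpline.ofReal_mem_splineSpace 𝕜 (hf.hasCompactSupport hl hcov hw),
      (hθ fun x => (f x : 𝕜)).2 fun j hj => by rw [hf.zero j hj, RCLike.ofReal_zero]⟩
  have hsupp : tsupport (fun x => (f x : 𝕜)) = Icc (lam a) (lam b) := by
    rw [tsupport_ofReal, hf.tsupport_eq hl hcov hw]
  constructor
  · rintro ⟨⟨h1, h2⟩, h3, h4, h5, h6⟩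
    obtain ⟨c, hc⟩ := h6 _ hmem (by
      rw [hsupp]
      exact Icc_subset_tsupport hl hcov hw h1 ((hθ Ψ).1 h2) h3 h4 h5)
    have h7 := congrFun hc (lam (a + 1))
    beta_reduce at h7
    rw [hf.one, h5, RCLike.ofReal_one, mul_one] at h7
    rw [hc, ← h7]
    simp
  · rintro rfl
    refine ⟨hmem, ?_, ?_, ?_, fun g hg hgs => ⟨g (lam (a + 1)), funext fun x => ?_⟩⟩
    · rw [HasCompactSupport, hsupp]
      exact isCompact_Icc
    · rw [hsupp]
      exact Icc_subset_Ici_self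
    · beta_reduce
      rw [hf.one, RCLike.ofReal_one]
    · rw [hsupp] at hgs
      exact hf.eq_mul_ofReal hl hcov hw hg.1 ((hθ g).1 hg.2) hgs x

/-- Counting inner nodes pins down the right end, hence the window; the prescribed integral then
fixes the factor, since `∫ f` is not zero. -/
theorem isBSpline_iff (hl : StrictMono lam) (hcov : ∀ x, ∃ j, lam j ≤ x ∧ x < lam (j + 1))
    (hf : IsWindowSpline lam ∅ q a (a + q + 2) f) {B : ℝ → 𝕜} :
    IsBSpline lam (q + 2) a B ↔
      B = fun x => (((lam (a + q + 2) - lam a) / (q + 2 : ℕ) / (∫ x, f x) * f x : ℝ) : 𝕜) := by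
  have hw := isWindow_empty q a
  have hI : (0 : ℝ) < ∫ x, f x := hf.integral_pos hl hcov rfl
  have hlen : 0 < lam (a + q + 2) - lam a := sub_pos.2 (hl (by omega))
  have hncard : ∀ n', (Ioo (lam a) (lam n') ∩ range lam).ncard = (n' - a - 1).toNat := by
    intro n'
    have : Ioo (lam a) (lam n') ∩ range lam = lam '' (Finset.Ioo a n' : Finset ℤ) := by
      ext x
      constructor
      · rintro ⟨hx, j, rfl⟩
        exact ⟨j, Finset.mem_coe.2 (Finset.mem_Ioo.2 ⟨hl.lt_iff_lt.1 hx.1, hl.lt_iff_lt.1 hx.2⟩),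
          rfl⟩
      · rintro ⟨j, hj, rfl⟩
        have := Finset.mem_Ioo.1 (Finset.mem_coe.1 hj)
        exact ⟨⟨hl this.1, hl this.2⟩, j, rfl⟩
    rw [this, Set.ncard_image_of_injective _ hl.injective, Set.ncard_coe_finset, Int.card_Ioo]
  constructor
  · rintro ⟨h1, n', h2, h3, h4⟩
    rw [hncard] at h3
    obtain rfl : n' = a + q + 2 := by omega
    have h5 := hf.eq_mul_ofReal hl hcov hw h1 (by simp) h2.subset
    rw [funext h5, integral_const_mul, integral_ofReal] at h4
    have h6 : ((∫ x, f x : ℝ) : 𝕜) ≠ 0 := RCLike.ofReal_ne_zero.2 hI.ne'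
    rw [funext h5, eq_div_of_mul_eq h6 h4]
    ext x
    push_cast
    ring
  · rintro rfl
    have hc : (lam (a + q + 2) - lam a) / (q + 2 : ℕ) / (∫ x, f x) ≠ 0 := by positivity
    have hsupp : tsupport (fun x => (lam (a + q + 2) - lam a) / (q + 2 : ℕ) / (∫ x, f x) * f x) =
        Icc (lam a) (lam (a + q + 2)) := by
      rw [← hf.tsupport_eq hl hcov hw, tsupport, tsupport]
      congr 1
      ext x
      simp only [Function.mem_support, ne_eq, mul_eq_zero, hc, false_or]
    refine ⟨(hf.isSpline.const_mul _).ofReal_mem_splineSpace 𝕜 ?_, a + q + 2, ?_, ?_, ?_⟩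
    · rw [HasCompactSupport, hsupp]
      exact isCompact_Icc
    · rw [tsupport_ofReal, hsupp]
    · rw [hncard]
      omega
    · rw [integral_ofReal, integral_const_mul, div_mul_cancel₀ _ hI.ne']

end IsWindowSpline

/-! ### Words as gap patterns -/

theorem letter_length_injective : Function.Injective Letter.length := by
  have h := inv_goldenRatio_lt_one
  rintro (_ | _) (_ | _) h' <;> simp only [Letter.length, one_div] at h' <;>
    first | rfl | (exfalso; linarith)

open Classical in
/-- The word of `s` letters with left-hand end `lam n`. -/
noncomputable def wordAt (s : ℕ) (n : ℤ) (i : Fin s) : Letter :=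
  if n + ((i : ℕ) : ℤ) ∈ range longIndex then Letter.L else Letter.S

section words

variable {lam : ℤ → ℝ}

theorem isWordAt_iff (hlam : ∀ k : ℤ, lam k = ((⌈(k : ℝ) * τ⁻¹⌉ : ℤ) + k * τ) / τ ^ 2) {s : ℕ}
    {n : ℤ} {w : Fin s → Letter} : IsWordAt lam n w ↔ w = wordAt s n := by
  have key : ∀ i : Fin s, lam (n + ((i : ℕ) : ℤ) + 1) - lam (n + ((i : ℕ) : ℤ)) =
      (wordAt s n i).length := by
    intro i
    have h := chain_gap hlam (n + ((i : ℕ) : ℤ))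
    rw [wordAt]
    split_ifs with h1
    · exact h.1 h1
    · rw [h.2 h1, Letter.length, one_div]
  constructor
  · intro h
    ext i
    exact letter_length_injective ((h i).symm.trans (key i))
  · rintro rfl i
    exact key i

theorem admissibleWords_eq_range
    (hlam : ∀ k : ℤ, lam k = ((⌈(k : ℝ) * τ⁻¹⌉ : ℤ) + k * τ) / τ ^ 2) (s : ℕ) :
    admissibleWords lam s = range (wordAt s) := by
  ext w
  exact exists_congr fun n => (isWordAt_iff hlam).trans eq_comm

theorem wordAt_eq_iff (hlam : ∀ k : ℤ, lam k = ((⌈(k : ℝ) * τ⁻¹⌉ : ℤ) + k * τ) / τ ^ 2) {s : ℕ}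
    {n n' : ℤ} : wordAt s n = wordAt s n' ↔
      ∀ k : ℤ, 0 ≤ k → k ≤ s → lam (n + k) - lam n = lam (n' + k) - lam n' := by
  constructor
  · intro h k hk
    induction k, hk using Int.leInduction with
    | base => simp
    | succ k hk ih =>
      intro hks
      have h1 := ih (by omega)
      have h2 := ((isWordAt_iff hlam).2 rfl : IsWordAt lam n (wordAt s n)) ⟨k.toNat, by omega⟩
      have h3 := ((isWordAt_iff hlam).2 h : IsWordAt lam n' (wordAt s n)) ⟨k.toNat, by omega⟩
      simp only [Int.toNat_of_nonneg hk] at h2 h3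
      rw [← add_assoc, ← add_assoc]
      linarith
  · intro h
    ext i
    have := mem_range_longIndex_iff_of_sub_eq hlam (h i (by omega) (by omega))
      (h (i + 1) (by omega) (by omega))
    unfold wordAt
    split_ifs <;> first | rfl | (exfalso; tauto)

end words

/-! ### Comparing scaling functions -/

section bspline

variable {lam : ℤ → ℝ} {q : ℕ} {B : ℤ → ℝ → ℝ}

/-- The factor between the B-spline and the spline normalized at its second node. -/
noncomputable def bsplineFactor (lam : ℤ → ℝ) (q : ℕ) (B : ℤ → ℝ → ℝ) (n : ℤ) : ℝ :=
  (lam (n + q + 2) - lam n) / (q + 2 : ℕ) / (∫ x, B n x)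

theorem scaling_eq_iff (hl : StrictMono lam) (hcov : ∀ x, ∃ j, lam j ≤ x ∧ x < lam (j + 1))
    (hB : ∀ n, IsWindowSpline lam ∅ q n (n + q + 2) (B n)) {n n' : ℤ} :
    (∀ x, bsplineFactor lam q B n * B n (x + lam n) =
      bsplineFactor lam q B n' * B n' (x + lam n')) ↔
    ∀ k : ℤ, 0 ≤ k → k ≤ (q + 2 : ℕ) → lam (n + k) - lam n = lam (n' + k) - lam n' := by
  have hpos : ∀ n, bsplineFactor lam q B n ≠ 0 := by
    intro n
    have h1 : 0 < ∫ x, B n x := (hB n).integral_pos hl hcov rfl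
    have h2 : 0 < lam (n + q + 2) - lam n := sub_pos.2 (hl (by omega))
    rw [bsplineFactor]
    positivity
  constructor
  · intro h k hk hkq
    exact (IsWindowSpline.nodes_eq hl hcov (isWindow_empty q n) (hB n) (isWindow_empty q n') (hB n')
      (Nat.zero_le q) (hpos n) (hpos n') (by simpa using h)).2 k hk (by push_cast at hkq; omega)
  · intro h x
    have h1 := (hB n).translate hl (a' := n') (b' := n' + q + 2) (by omega) (by ring)
      (fun k hk hkq => (h k hk (by push_cast; omega)).symm) (by simp)
    have h2 := (hB n').unique hl hcov (isWindow_empty q n') h1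
    have h3 : bsplineFactor lam q B n = bsplineFactor lam q B n' := by
      have h4 := h (q + 2) (by omega) (by push_cast; omega)
      rw [← add_assoc, ← add_assoc] at h4
      rw [bsplineFactor, bsplineFactor, ← h2, h4,
        integral_add_right_eq_self (fun x => B n x) (lam n - lam n')]
    rw [h3, ← h2]
    beta_reduce
    rw [show x + lam n' + (lam n - lam n') = x + lam n by ring]

end bspline

/-! ### Comparing minimal splines and wavelets -/

section minimal

variable {lam : ℤ → ℝ} {q s : ℕ} {F : ℤ → ℝ → ℝ}

/-- The indices of the nodes in `τ² Λ`. -/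
abbrev inflatedIndices : Set ℤ := {j | j - 1 ∉ range longIndex}

theorem vanish_inflated_iff {𝕜 : Type*} [RCLike 𝕜] (hl : StrictMono lam)
    (hlam : ∀ k : ℤ, lam k = ((⌈(k : ℝ) * τ⁻¹⌉ : ℤ) + k * τ) / τ ^ 2) (g : ℝ → 𝕜) :
    (∀ k, g (τ ^ 2 * lam k) = 0) ↔ ∀ j ∈ inflatedIndices, g (lam j) = 0 := by
  have hmem : ∀ j, j ∈ inflatedIndices ↔ ∃ k, τ ^ 2 * lam k = lam j := by
    intro j
    rw [mem_ofPred_eq, ← indexSet_eq_range hl hlam, indexSet, mem_ofPred_eq, not_not,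
      sub_add_cancel]
    rfl
  constructor
  · intro h j hj
    obtain ⟨k, hk⟩ := (hmem j).1 hj
    rw [← hk, h k]
  · intro h k
    rw [chain_inflation hlam]
    exact h _ ((hmem _).2 ⟨k, chain_inflation hlam k⟩)

/-- Membership of a node in the zero set depends on the tile to its left being short, so equal gaps
give equal zeros as well, and uniqueness applies to the translate. -/
theorem minimal_eq_of_floorIncrements_eq (hl : StrictMono lam)
    (hlam : ∀ k : ℤ, lam k = ((⌈(k : ℝ) * τ⁻¹⌉ : ℤ) + k * τ) / τ ^ 2)
    (hF : ∀ k, IsWindowSpline lam inflatedIndices q (longIndex k) (longIndex (k + q) + 2) (F k))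
    {k k' : ℤ} (h : floorIncrements τ (q + 1) k = floorIncrements τ (q + 1) k') (x : ℝ) :
    F k (x + lam (longIndex k)) = F k' (x + lam (longIndex k')) := by
  obtain ⟨h1, h2⟩ := (floorIncrements_goldenRatio_eq_iff hlam).1 h
  have h3 := (hF k).translate hl (a' := longIndex k') (b' := longIndex (k' + q) + 2)
    (isWindow_longIndex q k).add_one_lt h1 (fun i hi hi' => (h2 i hi hi').symm) (by
      intro i hi hi' hZ hmem
      have h4 := mem_range_longIndex_iff_of_sub_eq hlam (h2 (i - 1) (by omega) (by omega))
        (h2 (i - 1 + 1) (by omega) (by omega))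
      rw [← add_sub_assoc, ← add_sub_assoc] at h4
      exact hZ (h4.1 hmem))
  rw [← (hF k').unique hl (chain_cover hlam) (isWindow_longIndex q k') h3]
  beta_reduce
  rw [show x + lam (longIndex k') + (lam (longIndex k) - lam (longIndex k')) =
    x + lam (longIndex k) by ring]

theorem floorIncrements_eq_of_iteratedDeriv_eq (hl : StrictMono lam)
    (hlam : ∀ k : ℤ, lam k = ((⌈(k : ℝ) * τ⁻¹⌉ : ℤ) + k * τ) / τ ^ 2)
    (hF : ∀ k, IsWindowSpline lam inflatedIndices q (longIndex k) (longIndex (k + q) + 2) (F k))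
    (hs : s ≤ q) {k k' : ℤ} {r r' : ℝ} (hr : r ≠ 0) (hr' : r' ≠ 0)
    (h : ∀ x, r * iteratedDeriv s (F k) (x + lam (longIndex k)) =
      r' * iteratedDeriv s (F k') (x + lam (longIndex k'))) :
    floorIncrements τ (q + 1) k = floorIncrements τ (q + 1) k' :=
  (floorIncrements_goldenRatio_eq_iff hlam).2
    (IsWindowSpline.nodes_eq hl (chain_cover hlam) (isWindow_longIndex q k) (hF k)
      (isWindow_longIndex q k') (hF k') hs hr hr' h)

/-- The `L²` norm of the contracted wavelet shape is not zero. -/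
theorem toReal_eLpNorm_contracted_ne_zero (𝕜 : Type*) [RCLike 𝕜] (hl : StrictMono lam)
    (hcov : ∀ x, ∃ j, lam j ≤ x ∧ x < lam (j + 1)) {Z : Set ℤ} {a b : ℤ} (hw : IsWindow Z q a b)
    {f : ℝ → ℝ} (hf : IsWindowSpline lam Z q a b f) (hs : s ≤ q) {θ : ℝ} (hθ : 0 < θ) :
    (eLpNorm (fun y => ((iteratedDeriv s f (θ * y + lam a) : ℝ) : 𝕜)) 2 volume).toReal ≠ 0 := by
  have hc := hf.isSpline.contDiff.continuous_iteratedDeriv s (by exact_mod_cast hs)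
  have hne : ∃ x, iteratedDeriv s f x ≠ 0 := by
    by_contra! h
    have h1 := hf.tsupport_iteratedDeriv hl hcov hw hs
    rw [funext h] at h1
    have h2 : lam a ∈ Icc (lam a) (lam b) :=
      ⟨le_rfl, hl.monotone (by have := hw.add_one_lt; omega)⟩
    rw [← h1, tsupport_fun_zero] at h2
    exact h2
  obtain ⟨x, hx⟩ := hne
  refine toReal_eLpNorm_ne_zero (x := (x - lam a) / θ)
    (RCLike.continuous_ofReal.comp (hc.comp (by fun_prop))) ?_ ?_
  · refine HasCompactSupport.intro
      (isCompact_Icc (a := 0) (b := (lam b - lam a) / θ)) fun y hy => ?_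
    rw [mem_Icc, not_and_or, not_le, not_le] at hy
    rw [RCLike.ofReal_eq_zero]
    rcases hy with h | h
    · refine hf.iteratedDeriv_left hs _ ?_
      nlinarith
    · refine hf.iteratedDeriv_right hs _ ?_
      rw [div_lt_iff₀ hθ] at h
      linarith
  · rw [mul_div_cancel₀ _ hθ.ne', sub_add_cancel]
    exact RCLike.ofReal_ne_zero.2 hx

end minimal

end FibSpline

/-! ### The main theorem -/

open FibSpline in
theorem proposition8 {𝕜 : Type*} [RCLike 𝕜] (lam : ℤ → ℝ) (hmono : StrictMono lam)
    (hrange : Set.range lam = FibSpline.rescaledChain) (h0 : lam 0 = 0)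
    (s : ℕ) (hs : 2 ≤ s) (θ : ℝ) (hθ : θ = Real.goldenRatio ^ 2)
    (p : ℤ) (hp : p = ⌈(2 * (s : ℝ) - 2) * Real.goldenRatio⌉ + 1) :
    -- every node carries exactly one B-spline of order `s`
    (∀ n : ℤ, ∃! B : ℝ → 𝕜, FibSpline.IsBSpline lam s n B) ∧
    -- there are exactly `s + 1` admissible words and `s + 1` scaling functions, one per word
    (∀ n : ℤ, ∃ w : Fin s → FibSpline.Letter, FibSpline.IsWordAt lam n w) ∧
    (FibSpline.admissibleWords lam s).ncard = s + 1 ∧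
    (FibSpline.scalingFunctions 𝕜 lam s).ncard = s + 1 ∧
    (∃ φ : (Fin s → FibSpline.Letter) → (ℝ → 𝕜),
      Set.BijOn φ (FibSpline.admissibleWords lam s) (FibSpline.scalingFunctions 𝕜 lam s) ∧
      ∀ (n : ℤ) (w : Fin s → FibSpline.Letter), FibSpline.IsWordAt lam n w →
        FibSpline.IsBSpline lam s n (fun x => φ w (x - lam n))) ∧
    -- every admissible index carries exactly one minimally supported spline of order `2 s`
    (∀ n ∈ FibSpline.indexSet lam θ, ∃! Ψ : ℝ → 𝕜, FibSpline.IsMinimalSpline lam θ (2 * s) n Ψ) ∧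
    -- there are exactly `2 s` different wavelets, before and after derivation and normalization
    (FibSpline.minimalShapes 𝕜 lam θ s).ncard = 2 * s ∧
    (FibSpline.waveletShapes 𝕜 lam θ s).ncard = 2 * s ∧
    (FibSpline.motherWavelets 𝕜 lam θ s).ncard = 2 * s ∧
    -- the support of each of them is a word of `p` or of `p + 1` letters
    (∀ n ∈ FibSpline.indexSet lam θ, ∀ Ψ : ℝ → 𝕜, FibSpline.IsMinimalSpline lam θ (2 * s) n Ψ →
      ∃ N : ℤ, (N = p ∨ N = p + 1) ∧
        tsupport Ψ = Set.Icc (lam n) (lam (n + N)) ∧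
        tsupport (iteratedDeriv s Ψ) = Set.Icc (lam n) (lam (n + N))) ∧
    -- and both lengths occur
    (∀ N : ℤ, N = p ∨ N = p + 1 →
      ∃ n ∈ FibSpline.indexSet lam θ, ∃ Ψ : ℝ → 𝕜, FibSpline.IsMinimalSpline lam θ (2 * s) n Ψ ∧
        tsupport (iteratedDeriv s Ψ) = Set.Icc (lam n) (lam (n + N))) := by
  have hlam := chain_eq hmono hrange h0
  have hcov := chain_cover hlam
  obtain ⟨r, rfl⟩ : ∃ r, s = r + 2 := ⟨s - 2, by omega⟩
  -- The minimal splines have order `2 s = q + 2`, the B-splines order `r + 2`. From `2 ≤ s` follows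
  -- `s ≤ q`, so the derivative of order `s` is still continuous.
  set q := 2 * r + 2 with hq
  have hm : 2 * (r + 2) = q + 2 := by omega
  have hsq : r + 2 ≤ q := by omega
  have hp' : p = ⌈(q : ℝ) * Real.goldenRatio⌉ + 1 := by
    rw [hp, hq]
    push_cast
    ring_nf
  have hθ0 : 0 < θ := by rw [hθ]; have := Real.goldenRatio_pos; positivity
  -- B-splines and scaling functions
  choose B hB using fun n : ℤ =>
    IsWindowSpline.exists_of_window hmono hcov (isWindow_empty r n)
  have hBiff : ∀ (n : ℤ) (b : ℝ → 𝕜), IsBSpline lam (r + 2) n b ↔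
      b = fun x => ((bsplineFactor lam r B n * B n x : ℝ) : 𝕜) :=
    fun n b => (hB n).isBSpline_iff hmono hcov
  let σ : ℤ → ℝ → 𝕜 := fun n x => ((bsplineFactor lam r B n * B n (x + lam n) : ℝ) : 𝕜)
  have hσ : scalingFunctions 𝕜 lam (r + 2) = range σ := by
    ext φ
    constructor
    · rintro ⟨n, b, hb, rfl⟩
      exact ⟨n, by rw [(hBiff n b).1 hb]⟩
    · rintro ⟨n, rfl⟩
      exact ⟨n, _, (hBiff n _).2 rfl, rfl⟩
  have hσw : ∀ n n', σ n = σ n' ↔ wordAt (r + 2) n = wordAt (r + 2) n' := by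
    intro n n'
    rw [wordAt_eq_iff hlam, ← scaling_eq_iff hmono hcov hB, funext_iff]
    exact forall_congr' fun x => RCLike.ofReal_inj
  have hadm := admissibleWords_eq_range hlam (r + 2)
  have hwcard : (range (wordAt (r + 2))).ncard = r + 2 + 1 := by
    rw [ncard_range_congr (g := floorIncrements (-Real.goldenRatio⁻¹) (r + 2)) fun n n' =>
      (wordAt_eq_iff hlam).trans (chain_sub_eq_iff hlam).symm]
    exact ncard_range_floorIncrements irrational_inv_goldenRatio.neg _
  have hext : ∀ n, Function.extend (wordAt (r + 2)) σ 0 (wordAt (r + 2) n) = σ n := fun n =>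
    Function.FactorsThrough.extend_apply (fun x y hxy => (hσw x y).2 hxy) _ n
  -- minimally supported splines and wavelets
  choose F hF using fun k : ℤ =>
    IsWindowSpline.exists_of_window hmono hcov (isWindow_longIndex q k)
  have hidx : indexSet lam θ = range longIndex := by rw [hθ, indexSet_eq_range hmono hlam]
  have hFiff : ∀ (k : ℤ) (Ψ : ℝ → 𝕜), IsMinimalSpline lam θ (2 * (r + 2)) (longIndex k) Ψ ↔
      Ψ = fun x => (F k x : 𝕜) := by
    intro k Ψ
    rw [hm]
    exact (hF k).isMinimalSpline_iff hmono hcov (isWindow_longIndex q k)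
      (by rw [hθ]; exact vanish_inflated_iff hmono hlam)
  have hderiv : ∀ k, iteratedDeriv (r + 2) (fun x => (F k x : 𝕜)) =
      fun x => ((iteratedDeriv (r + 2) (F k) x : ℝ) : 𝕜) := fun k =>
    iteratedDeriv_ofReal 𝕜 ((hF k).isSpline.contDiff.of_le (by exact_mod_cast hsq))
  let Φ : ℤ → ℝ → 𝕜 := fun k x => (F k (x + lam (longIndex k)) : 𝕜)
  let ζ : ℤ → ℝ → 𝕜 := fun k x => ((iteratedDeriv (r + 2) (F k) (x + lam (longIndex k)) : ℝ) : 𝕜)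
  let c : ℤ → ℝ := fun k => (eLpNorm (fun y => ζ k (θ * y)) 2 volume).toReal
  let ψ : ℤ → ℝ → 𝕜 := fun k x => (c k)⁻¹ • ζ k (θ * x)
  have hΦ : minimalShapes 𝕜 lam θ (r + 2) = range Φ := by
    ext g
    rw [minimalShapes, hidx]
    constructor
    · rintro ⟨_, ⟨k, rfl⟩, Ψ, hΨ, rfl⟩
      exact ⟨k, by rw [(hFiff k Ψ).1 hΨ]⟩
    · rintro ⟨k, rfl⟩
      exact ⟨_, ⟨k, rfl⟩, _, (hFiff k _).2 rfl, rfl⟩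
  have hζ : waveletShapes 𝕜 lam θ (r + 2) = range ζ := by
    ext g
    rw [waveletShapes, hidx]
    constructor
    · rintro ⟨_, ⟨k, rfl⟩, Ψ, hΨ, rfl⟩
      exact ⟨k, by rw [(hFiff k Ψ).1 hΨ, hderiv]⟩
    · rintro ⟨k, rfl⟩
      exact ⟨_, ⟨k, rfl⟩, _, (hFiff k _).2 rfl, by rw [hderiv]⟩
  have hψ : motherWavelets 𝕜 lam θ (r + 2) = range ψ := by
    ext g
    rw [motherWavelets, hζ]
    constructor
    · rintro ⟨_, ⟨k, rfl⟩, rfl⟩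
      exact ⟨k, rfl⟩
    · rintro ⟨k, rfl⟩
      exact ⟨_, ⟨k, rfl⟩, rfl⟩
  have hc : ∀ k, (c k)⁻¹ ≠ 0 := fun k => inv_ne_zero
    (toReal_eLpNorm_contracted_ne_zero 𝕜 hmono hcov (isWindow_longIndex q k) (hF k) hsq hθ0)
  -- Equality of `Φ`, of `ζ`, of `ψ` and of the gap pattern imply one another in a cycle, so all
  -- these families have the same number of members.
  have hζΦ : ∀ k k', Φ k = Φ k' → ζ k = ζ k' := by
    intro k k' h
    have h1 : ∀ k, iteratedDeriv (r + 2) (Φ k) = ζ k := by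
      intro k
      refine (iteratedDeriv_comp_add_const (r + 2) (fun x => (F k x : 𝕜))
        (lam (longIndex k))).trans ?_
      rw [hderiv]
    rw [← h1, ← h1, h]
  have hψζ : ∀ k k', ζ k = ζ k' → ψ k = ψ k' := by
    intro k k' h
    simp only [ψ, c, h]
  have hΦD : ∀ k k', floorIncrements Real.goldenRatio (q + 1) k =
      floorIncrements Real.goldenRatio (q + 1) k' → Φ k = Φ k' := by
    intro k k' h
    ext x
    exact congrArg _ (minimal_eq_of_floorIncrements_eq hmono hlam hF h x)
  have hDψ : ∀ k k', ψ k = ψ k' → floorIncrements Real.goldenRatio (q + 1) k =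
      floorIncrements Real.goldenRatio (q + 1) k' := by
    intro k k' h
    refine floorIncrements_eq_of_iteratedDeriv_eq hmono hlam hF hsq (hc k) (hc k') fun x => ?_
    -- Evaluation at `x / θ` undoes the contraction; the nonzero norms remain as factors.
    have h1 := congrFun h (x / θ)
    simp only [ψ, ζ, mul_div_cancel₀ _ hθ0.ne', RCLike.real_smul_eq_coe_mul] at h1
    exact_mod_cast h1
  have hD : (range (floorIncrements Real.goldenRatio (q + 1))).ncard = 2 * (r + 2) := by
    rw [ncard_range_floorIncrements Real.goldenRatio_irrational]
    omega
  refine ⟨fun n => ⟨_, (hBiff n _).2 rfl, fun b hb => (hBiff n b).1 hb⟩,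
    fun n => ⟨_, (isWordAt_iff hlam).2 rfl⟩, by rw [hadm, hwcard],
    by rw [hσ, ncard_range_congr hσw, hwcard], ⟨Function.extend (wordAt (r + 2)) σ 0, ?_, ?_⟩,
    ?_, ?_, ?_, ?_, ?_, ?_⟩
  · rw [hadm, hσ]
    refine ⟨?_, ?_, ?_⟩
    · rintro _ ⟨n, rfl⟩
      exact ⟨n, (hext n).symm⟩
    · rintro _ ⟨n, rfl⟩ _ ⟨n', rfl⟩ h
      rw [hext, hext] at h
      exact (hσw n n').1 h
    · rintro _ ⟨n, rfl⟩
      exact ⟨_, ⟨n, rfl⟩, hext n⟩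
  · intro n w hw
    rw [(isWordAt_iff hlam).1 hw, hext, hBiff]
    ext x
    simp only [σ, sub_add_cancel]
  · rw [hidx]
    rintro _ ⟨k, rfl⟩
    exact ⟨_, (hFiff k _).2 rfl, fun Ψ hΨ => (hFiff k Ψ).1 hΨ⟩
  · rw [hΦ, ← hD]
    exact ncard_range_congr fun k k' =>
      ⟨fun h => hDψ k k' (hψζ k k' (hζΦ k k' h)), hΦD k k'⟩
  · rw [hζ, ← hD]
    exact ncard_range_congr fun k k' =>
      ⟨fun h => hDψ k k' (hψζ k k' h), fun h => hζΦ k k' (hΦD k k' h)⟩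
  · rw [hψ, ← hD]
    exact ncard_range_congr fun k k' =>
      ⟨hDψ k k', fun h => hψζ k k' (hζΦ k k' (hΦD k k' h))⟩
  · rw [hidx]
    rintro _ ⟨k, rfl⟩ Ψ hΨ
    rw [(hFiff k Ψ).1 hΨ, hderiv, tsupport_ofReal, tsupport_ofReal]
    refine ⟨longIndex (k + q) + 2 - longIndex k, hp' ▸ longIndex_window_length q k, ?_⟩
    rw [add_sub_cancel]
    exact ⟨(hF k).tsupport_eq hmono hcov (isWindow_longIndex q k),
      (hF k).tsupport_iteratedDeriv hmono hcov (isWindow_longIndex q k) hsq⟩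
  · rw [hidx]
    intro N hN
    obtain ⟨k, hk⟩ : ∃ k, longIndex (k + q) + 2 - longIndex k = N := by
      rcases hN with rfl | rfl
      · exact ⟨0, by rw [hp', longIndex_window_length_zero (by omega)]⟩
      · exact ⟨-q, by rw [hp', longIndex_window_length_neg]⟩
    refine ⟨_, ⟨k, rfl⟩, _, (hFiff k _).2 rfl, ?_⟩
    rw [hderiv, tsupport_ofReal, ← hk, add_sub_cancel]
    exact (hF k).tsupport_iteratedDeriv hmono hcov (isWindow_longIndex q k) hsq
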